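/- Let $q\in\mathbb C\setminus\{0\}$ not be a root of unity and fix a square root $q^{1/2}$ (so $q^m$ is defined for $m\in\frac12\mathbb Z$); write $[a]=\frac{q^a-q^{-a}}{q-q^{-1}}$ and $\mathrm i=\sqrt{-1}$. **Algebras.** $U_q(\mathrm{so}_3)$ is the unital complex associative algebra generated by $I_1,I_2,I_3$ with relations $[I_1,I_2]_q=I_3$, $[I_2,I_3]_q=I_1$, $[I_3,I_1]_q=I_2$, where $[a,b]_q=q^{1/2}ab-q^{-1/2}ba$. $U_q(\mathrm{sl}_2)$ is generated by $q^{H},q^{-H},E,F$ with relations $q^Hq^{-H}=q^{-H}q^H=1$, $q^HEq^{-H}=qE$, $q^HFq^{-H}=q^{-1}F$, $EF-FE=\frac{q^{2H}-q^{-2H}}{q-q^{-1}}$, and has the comultiplication $\Delta(q^{\pm H})=q^{\pm H}\otimes q^{\pm H}$, $\Delta(E)=E\otimes q^H+q^{-H}\otimes E$, $\Delta(F)=F\otimes q^H+q^{-H}\otimes F$. $\hat U_q(\mathrm{sl}_2)$ is the algebra obtained by adjoining to $U_q(\mathrm{sl}_2)$ inverses $(q^kq^H+q^{-k}q^{-H})^{-1}$,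 $k\in\mathbb Z$, with the relations $$q^{\pm H}(q^kq^H+q^{-k}q^{-H})^{-1}=(q^kq^H+q^{-k}q^{-H})^{-1}q^{\pm H},$$ $$(q^kq^H+q^{-k}q^{-H})^{-1}E=E(q^{k+1}q^H+q^{-k-1}q^{-H})^{-1},\qquad (q^kq^H+q^{-k}q^{-H})^{-1}F=F(q^{k-1}q^H+q^{-k+1}q^{-H})^{-1}.$$ Let $\psi:U_q(\mathrm{so}_3)\to\hat U_q(\mathrm{sl}_2)$ be the algebra homomorphism with $$\psi(I_1)=\tfrac{\mathrm i}{q-q^{-1}}(q^H-q^{-H}),\quad \psi(I_2)=(E-F)(q^H+q^{-H})^{-1},\quad \psi(I_3)=(\mathrm i q^{H-1/2}E+\mathrm i q^{-H-1/2}F)(q^H+q^{-H})^{-1}.$$ **Representations.** For $l\in\{0,\frac12,1,\dots\}$ let $T^{(1)}_l$ be the representation of $U_q(\mathrm{sl}_2)$ on the space with basis $|m\rangle$, $m=-l,-l+1,\dots,l$, given by $$q^{H}|m\rangle=q^m|m\rangle,\quad E|m\rangle=[l-m]\,|m+1\rangle,\quad F|m\rangle=[l+m]\,|m-1\rangle;$$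 for $\omega=\pm1$ let $T^{(\omega\mathrm i)}_l$ be the representation on the same space given by $$q^{H}|m\rangle=\omega\mathrm i\,q^m|m\rangle,\quad E|m\rangle=[l-m]\,|m+1\rangle,\quad F|m\rangle=-[l+m]\,|m-1\rangle.$$ A representation $T$ of $U_q(\mathrm{sl}_2)$ is called extendable if all operators $q^kT(q^H)+q^{-k}T(q^{-H})$, $k\in\mathbb Z$, are invertible; it is then extended to $\hat U_q(\mathrm{sl}_2)$ by sending $(q^kq^H+q^{-k}q^{-H})^{-1}$ to the inverse of this operator. $T^{(1)}_l$ is always extendable and $T^{(\pm\mathrm i)}_l$ is extendable for $l\in\{\frac12,\frac32,\dots\}$; put $R^{(1)}_l=T^{(1)}_l\circ\psi$ for all $l$, and $R^{(\pm\mathrm i)}_l=T^{(\pm\mathrm i)}_l\circ\psi$ for $l\in\{\frac12,\frac32,\dots\}$. For $R=T\circ\psi$ and $R'=T'\circ\psi$ with $T\otimes T'$ (formed with $\Delta$) extendable, define $R\otimes R'=(T\otimes T')\circ\psi$. **Statement.** The following holds, where $\simeq$ denotes equivalence of representations of $U_q(\mathrm{so}_3)$ and $j$ runs through $|l-l'|,|l-l'|+1,\dots,l+l'$.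 1. For all $l,l'\in\{0,\frac12,1,\dots\}$, $T^{(1)}_l\otimes T^{(1)}_{l'}$ is extendable and $R^{(1)}_l\otimes R^{(1)}_{l'}\simeq\bigoplus_{j}R^{(1)}_j$. 2. For $\omega=\pm1$, $l\in\{0,\frac12,1,\dots\}$ and $l'\in\{\frac12,\frac32,\dots\}$, $T^{(1)}_l\otimes T^{(\omega\mathrm i)}_{l'}$ is extendable if and only if $l$ is an integer, and in that case $R^{(1)}_l\otimes R^{(\omega\mathrm i)}_{l'}\simeq\bigoplus_{j}R^{(\omega\mathrm i)}_j$. 3. For $\omega=\pm1$, $l\in\{\frac12,\frac32,\dots\}$ and $l'\in\{0,\frac12,1,\dots\}$, $T^{(\omega\mathrm i)}_l\otimes T^{(1)}_{l'}$ is extendable if and only if $l'$ is an integer, and in that case $R^{(\omega\mathrm i)}_l\otimes R^{(1)}_{l'}\simeq\bigoplus_{j}R^{(\omega\mathrm i)}_j$. 4. For $\omega,\omega'=\pm1$ and $l,l'\in\{\frac12,\frac32,\dots\}$, $T^{(\omega\mathrm i)}_l\otimes T^{(\omega'\mathrm i)}_{l'}$ is extendable and $R^{(\omega\mathrm i)}_l\otimes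 R^{(\omega'\mathrm i)}_{l'}\simeq\bigoplus_{j}R^{(1)}_j$. -/

import Mathlib

open scoped TensorProduct DirectSum

noncomputable section

namespace QSo3

/-- The standing assumptions on the deformation parameter: `q` is a non-zero complex number which
is not a root of unity, and `s` is a fixed square root `q^{1/2}` of it.  For a half-integer `m`,
the power `q^m` means `s^{2m}`. -/
structure IsGenericParam (q s : ℂ) : Prop where
  sq : s ^ 2 = q
  ne_zero : q ≠ 0
  not_root_of_unity : ∀ n : ℕ, 0 < n → q ^ n ≠ 1

/-! ### The algebra `U_q(so_3)` -/

/-- Generators `I_1, I_2, I_3`. -/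
inductive So3Gen
  | I1 | I2 | I3

open FreeAlgebra in
/-- The relations `[I_1,I_2]_q = I_3`, `[I_2,I_3]_q = I_1`, `[I_3,I_1]_q = I_2` with
`[a,b]_q = q^{1/2} a b - q^{-1/2} b a` and `s = q^{1/2}`. -/
inductive So3Rel (s : ℂ) : FreeAlgebra ℂ So3Gen → FreeAlgebra ℂ So3Gen → Prop
  | rel12 : So3Rel s
      (s • (ι ℂ So3Gen.I1 * ι ℂ So3Gen.I2) - s⁻¹ • (ι ℂ So3Gen.I2 * ι ℂ So3Gen.I1))
      (ι ℂ So3Gen.I3)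
  | rel23 : So3Rel s
      (s • (ι ℂ So3Gen.I2 * ι ℂ So3Gen.I3) - s⁻¹ • (ι ℂ So3Gen.I3 * ι ℂ So3Gen.I2))
      (ι ℂ So3Gen.I1)
  | rel31 : So3Rel s
      (s • (ι ℂ So3Gen.I3 * ι ℂ So3Gen.I1) - s⁻¹ • (ι ℂ So3Gen.I1 * ι ℂ So3Gen.I3))
      (ι ℂ So3Gen.I2)

/-- The algebra `U_q(so_3)`, where `s = q^{1/2}`. -/
abbrev Uso3 (s : ℂ) : Type := RingQuot (So3Rel s)

/-! ### The algebra `U_q(sl_2)` and its comultiplication -/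

/-- Generators `q^H, q^{-H}, E, F`. -/
inductive Sl2Gen
  | K | Kinv | E | F

open FreeAlgebra in
/-- The defining relations of `U_q(sl_2)`, with `K = q^H` and `Kinv = q^{-H}`. -/
inductive Sl2Rel (q : ℂ) : FreeAlgebra ℂ Sl2Gen → FreeAlgebra ℂ Sl2Gen → Prop
  | K_Kinv : Sl2Rel q (ι ℂ Sl2Gen.K * ι ℂ Sl2Gen.Kinv) 1
  | Kinv_K : Sl2Rel q (ι ℂ Sl2Gen.Kinv * ι ℂ Sl2Gen.K) 1
  | K_E : Sl2Rel q (ι ℂ Sl2Gen.K * ι ℂ Sl2Gen.E * ι ℂ Sl2Gen.Kinv) (q • ι ℂ Sl2Gen.E)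
  | K_F : Sl2Rel q (ι ℂ Sl2Gen.K * ι ℂ Sl2Gen.F * ι ℂ Sl2Gen.Kinv) (q⁻¹ • ι ℂ Sl2Gen.F)
  | E_F : Sl2Rel q (ι ℂ Sl2Gen.E * ι ℂ Sl2Gen.F - ι ℂ Sl2Gen.F * ι ℂ Sl2Gen.E)
      ((q - q⁻¹)⁻¹ • (ι ℂ Sl2Gen.K ^ 2 - ι ℂ Sl2Gen.Kinv ^ 2))

/-- The algebra `U_q(sl_2)`. -/
abbrev Usl2 (q : ℂ) : Type := RingQuot (Sl2Rel q)

/-- The class of a generator in `U_q(sl_2)`. -/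
def Usl2.gen (q : ℂ) (g : Sl2Gen) : Usl2 q :=
  RingQuot.mkAlgHom ℂ (Sl2Rel q) (FreeAlgebra.ι ℂ g)

/-- Elements of an algebra satisfying the defining relations of `U_q(sl_2)`. -/
structure Sl2Relations {A : Type*} [Ring A] [Algebra ℂ A] (q : ℂ) (K Kinv E F : A) : Prop where
  K_Kinv : K * Kinv = 1
  Kinv_K : Kinv * K = 1
  K_E : K * E * Kinv = q • E
  K_F : K * F * Kinv = q⁻¹ • F
  E_F : E * F - F * E = (q - q⁻¹)⁻¹ • (K ^ 2 - Kinv ^ 2)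

theorem Usl2.relations (q : ℂ) :
    Sl2Relations q (gen q .K) (gen q .Kinv) (gen q .E) (gen q .F) := by
  constructor
  · simpa [gen] using RingQuot.mkAlgHom_rel ℂ (Sl2Rel.K_Kinv (q := q))
  · simpa [gen] using RingQuot.mkAlgHom_rel ℂ (Sl2Rel.Kinv_K (q := q))
  · simpa [gen] using RingQuot.mkAlgHom_rel ℂ (Sl2Rel.K_E (q := q))
  · simpa [gen] using RingQuot.mkAlgHom_rel ℂ (Sl2Rel.K_F (q := q))
  · simpa [gen] using RingQuot.mkAlgHom_rel ℂ (Sl2Rel.E_F (q := q))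

/-- The homomorphism from `U_q(sl_2)` with prescribed values on the generators. -/
def Usl2.lift {A : Type*} [Ring A] [Algebra ℂ A] {q : ℂ} {K Kinv E F : A}
    (h : Sl2Relations q K Kinv E F) : Usl2 q →ₐ[ℂ] A :=
  RingQuot.liftAlgHom ℂ
    ⟨FreeAlgebra.lift ℂ (fun g => match g with
      | .K => K
      | .Kinv => Kinv
      | .E => E
      | .F => F), by
      intro x y hxy
      cases hxy
      · simpa using h.K_Kinv
      · simpa using h.Kinv_K
      · simpa using h.K_E
      · simpa using h.K_F
      · simpa using h.E_F⟩

theorem Sl2Relations.comm {A : Type*} [Ring A] [Algebra ℂ A] {q : ℂ} {K Kinv E F : A}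
    (h : Sl2Relations q K Kinv E F) (hq : q ≠ 0) :
    K * E = q • (E * K) ∧ K * F = q⁻¹ • (F * K) ∧
      Kinv * E = q⁻¹ • (E * Kinv) ∧ Kinv * F = q • (F * Kinv) := by
  have e1 : K * E = q • (E * K) := by
    have := congrArg (· * K) h.K_E
    simpa [mul_assoc, h.Kinv_K] using this
  have e2 : K * F = q⁻¹ • (F * K) := by
    have := congrArg (· * K) h.K_F
    simpa [mul_assoc, h.Kinv_K] using this
  refine ⟨e1, e2, ?_, ?_⟩
  · have : Kinv * (K * E) * Kinv = q • (Kinv * (E * K) * Kinv) := by rw [e1]; simp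
    rw [← mul_assoc, h.Kinv_K, one_mul, mul_assoc, mul_assoc, h.K_Kinv, mul_one] at this
    rw [this, smul_smul, inv_mul_cancel₀ hq, one_smul]
  · have : Kinv * (K * F) * Kinv = q⁻¹ • (Kinv * (F * K) * Kinv) := by rw [e2]; simp
    rw [← mul_assoc, h.Kinv_K, one_mul, mul_assoc, mul_assoc, h.K_Kinv, mul_one] at this
    rw [this, smul_smul, mul_inv_cancel₀ hq, one_smul]

/-- The elements `Δ(q^{±H}) = q^{±H} ⊗ q^{±H}`, `Δ(E) = E ⊗ q^H + q^{-H} ⊗ E`,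
`Δ(F) = F ⊗ q^H + q^{-H} ⊗ F` satisfy the defining relations. -/
theorem Usl2.comul_relations (q : ℂ) (hq : q ≠ 0) :
    Sl2Relations (A := Usl2 q ⊗[ℂ] Usl2 q) q
      (gen q .K ⊗ₜ gen q .K) (gen q .Kinv ⊗ₜ gen q .Kinv)
      (gen q .E ⊗ₜ gen q .K + gen q .Kinv ⊗ₜ gen q .E)
      (gen q .F ⊗ₜ gen q .K + gen q .Kinv ⊗ₜ gen q .F) := by
  have h := Usl2.relations q
  obtain ⟨c1, c2, c3, c4⟩ := h.comm hq
  generalize gen q .K = K at *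
  generalize gen q .Kinv = L at *
  generalize gen q .E = E at *
  generalize gen q .F = F at *
  have hKL := h.K_Kinv
  have hLK := h.Kinv_K
  constructor
  · simp [hKL, Algebra.TensorProduct.one_def]
  · simp [hLK, Algebra.TensorProduct.one_def]
  · simp [mul_add, add_mul, h.K_E, mul_assoc K K L, hKL, TensorProduct.smul_tmul', TensorProduct.tmul_smul]
  · simp [mul_add, add_mul, h.K_F, mul_assoc K K L, hKL, TensorProduct.smul_tmul', TensorProduct.tmul_smul]
  · have hEF : E * F = F * E + (q - q⁻¹)⁻¹ • (K ^ 2 - L ^ 2) := by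
      rw [← h.E_F]; abel
    simp only [mul_add, add_mul, Algebra.TensorProduct.tmul_mul_tmul, c1, c2, c3, c4, hEF,
      TensorProduct.add_tmul, TensorProduct.tmul_add,
      TensorProduct.sub_tmul, TensorProduct.tmul_sub, TensorProduct.smul_tmul',
      TensorProduct.tmul_smul, smul_sub, pow_two]
    abel

/-- The comultiplication of `U_q(sl_2)`. -/
def Usl2.comul (q : ℂ) (hq : q ≠ 0) : Usl2 q →ₐ[ℂ] Usl2 q ⊗[ℂ] Usl2 q :=
  Usl2.lift (Usl2.comul_relations q hq)

/-! ### The algebra `Û_q(sl_2)` -/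

/-- Generators `q^H, q^{-H}, E, F` and `D k = (q^k q^H + q^{-k} q^{-H})^{-1}`, `k ∈ ℤ`. -/
inductive HatGen
  | K | Kinv | E | F
  | D (k : ℤ)

open FreeAlgebra in
/-- The defining relations of `Û_q(sl_2)`: those of `U_q(sl_2)` together with the natural relations
for the inverses `D k`. -/
inductive HatRel (q : ℂ) : FreeAlgebra ℂ HatGen → FreeAlgebra ℂ HatGen → Prop
  | K_Kinv : HatRel q (ι ℂ HatGen.K * ι ℂ HatGen.Kinv) 1
  | Kinv_K : HatRel q (ι ℂ HatGen.Kinv * ι ℂ HatGen.K) 1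
  | K_E : HatRel q (ι ℂ HatGen.K * ι ℂ HatGen.E * ι ℂ HatGen.Kinv) (q • ι ℂ HatGen.E)
  | K_F : HatRel q (ι ℂ HatGen.K * ι ℂ HatGen.F * ι ℂ HatGen.Kinv) (q⁻¹ • ι ℂ HatGen.F)
  | E_F : HatRel q (ι ℂ HatGen.E * ι ℂ HatGen.F - ι ℂ HatGen.F * ι ℂ HatGen.E)
      ((q - q⁻¹)⁻¹ • (ι ℂ HatGen.K ^ 2 - ι ℂ HatGen.Kinv ^ 2))
  | D_left (k : ℤ) : HatRel q
      (ι ℂ (HatGen.D k) * (q ^ k • ι ℂ HatGen.K + q ^ (-k) • ι ℂ HatGen.Kinv)) 1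
  | D_right (k : ℤ) : HatRel q
      ((q ^ k • ι ℂ HatGen.K + q ^ (-k) • ι ℂ HatGen.Kinv) * ι ℂ (HatGen.D k)) 1
  | K_D (k : ℤ) : HatRel q (ι ℂ HatGen.K * ι ℂ (HatGen.D k)) (ι ℂ (HatGen.D k) * ι ℂ HatGen.K)
  | Kinv_D (k : ℤ) : HatRel q
      (ι ℂ HatGen.Kinv * ι ℂ (HatGen.D k)) (ι ℂ (HatGen.D k) * ι ℂ HatGen.Kinv)
  | D_E (k : ℤ) : HatRel q
      (ι ℂ (HatGen.D k) * ι ℂ HatGen.E) (ι ℂ HatGen.E * ι ℂ (HatGen.D (k + 1)))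
  | D_F (k : ℤ) : HatRel q
      (ι ℂ (HatGen.D k) * ι ℂ HatGen.F) (ι ℂ HatGen.F * ι ℂ (HatGen.D (k - 1)))

/-- The algebra `Û_q(sl_2)`. -/
abbrev Uhat (q : ℂ) : Type := RingQuot (HatRel q)

/-- The class of a generator in `Û_q(sl_2)`. -/
def Uhat.gen (q : ℂ) (g : HatGen) : Uhat q :=
  RingQuot.mkAlgHom ℂ (HatRel q) (FreeAlgebra.ι ℂ g)

theorem Uhat.relations (q : ℂ) :
    Sl2Relations q (gen q .K) (gen q .Kinv) (gen q .E) (gen q .F) := by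
  constructor
  · simpa [gen] using RingQuot.mkAlgHom_rel ℂ (HatRel.K_Kinv (q := q))
  · simpa [gen] using RingQuot.mkAlgHom_rel ℂ (HatRel.Kinv_K (q := q))
  · simpa [gen] using RingQuot.mkAlgHom_rel ℂ (HatRel.K_E (q := q))
  · simpa [gen] using RingQuot.mkAlgHom_rel ℂ (HatRel.K_F (q := q))
  · simpa [gen] using RingQuot.mkAlgHom_rel ℂ (HatRel.E_F (q := q))

theorem Uhat.D_right (q : ℂ) (k : ℤ) :
    (q ^ k • gen q .K + q ^ (-k) • gen q .Kinv) * gen q (.D k) = 1 := by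
  simpa [gen] using RingQuot.mkAlgHom_rel ℂ (HatRel.D_right (q := q) k)

theorem Uhat.K_D (q : ℂ) (k : ℤ) : gen q .K * gen q (.D k) = gen q (.D k) * gen q .K := by
  simpa [gen] using RingQuot.mkAlgHom_rel ℂ (HatRel.K_D (q := q) k)

theorem Uhat.Kinv_D (q : ℂ) (k : ℤ) :
    gen q .Kinv * gen q (.D k) = gen q (.D k) * gen q .Kinv := by
  simpa [gen] using RingQuot.mkAlgHom_rel ℂ (HatRel.Kinv_D (q := q) k)

theorem Uhat.D_E (q : ℂ) (k : ℤ) :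
    gen q (.D k) * gen q .E = gen q .E * gen q (.D (k + 1)) := by
  simpa [gen] using RingQuot.mkAlgHom_rel ℂ (HatRel.D_E (q := q) k)

theorem Uhat.D_F (q : ℂ) (k : ℤ) :
    gen q (.D k) * gen q .F = gen q .F * gen q (.D (k - 1)) := by
  simpa [gen] using RingQuot.mkAlgHom_rel ℂ (HatRel.D_F (q := q) k)

/-! ### The homomorphism `ψ : U_q(so_3) → Û_q(sl_2)` -/

theorem IsGenericParam.s_ne_zero {q s : ℂ} (h : IsGenericParam q s) : s ≠ 0 := by
  rintro rfl
  exact h.ne_zero (by simpa using h.sq.symm)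

theorem IsGenericParam.sub_inv_ne_zero {q s : ℂ} (h : IsGenericParam q s) : q - q⁻¹ ≠ 0 := by
  intro h0
  apply h.not_root_of_unity 2 (by norm_num)
  have := h.ne_zero
  field_simp at h0
  linear_combination h0

/-- `ψ(I_1) = i (q - q^{-1})^{-1} (q^H - q^{-H})`. -/
def psiI1 (q : ℂ) : Uhat q :=
  (Complex.I / (q - q⁻¹)) • (Uhat.gen q .K - Uhat.gen q .Kinv)

/-- `ψ(I_2) = (E - F) (q^H + q^{-H})^{-1}`. -/
def psiI2 (q : ℂ) : Uhat q :=
  (Uhat.gen q .E - Uhat.gen q .F) * Uhat.gen q (.D 0)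

/-- `ψ(I_3) = (i q^{H-1/2} E + i q^{-H-1/2} F) (q^H + q^{-H})^{-1}`. -/
def psiI3 (q s : ℂ) : Uhat q :=
  ((Complex.I * s⁻¹) • (Uhat.gen q .K * Uhat.gen q .E) +
    (Complex.I * s⁻¹) • (Uhat.gen q .Kinv * Uhat.gen q .F)) * Uhat.gen q (.D 0)

/-- Commutation rules that move `E`, `F` to the left of `q^{±H}`, and those to the left of `D k`. -/
theorem Uhat.normal_order (q : ℂ) (hq : q ≠ 0) :
    (∀ x, gen q .K * (gen q .E * x) = q • (gen q .E * (gen q .K * x))) ∧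
    (∀ x, gen q .K * (gen q .F * x) = q⁻¹ • (gen q .F * (gen q .K * x))) ∧
    (∀ x, gen q .Kinv * (gen q .E * x) = q⁻¹ • (gen q .E * (gen q .Kinv * x))) ∧
    (∀ x, gen q .Kinv * (gen q .F * x) = q • (gen q .F * (gen q .Kinv * x))) ∧
    (∀ k x, gen q (.D k) * (gen q .E * x) = gen q .E * (gen q (.D (k + 1)) * x)) ∧
    (∀ k x, gen q (.D k) * (gen q .F * x) = gen q .F * (gen q (.D (k - 1)) * x)) ∧
    (∀ k x, gen q (.D k) * (gen q .K * x) = gen q .K * (gen q (.D k) * x)) ∧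
    (∀ k x, gen q (.D k) * (gen q .Kinv * x) = gen q .Kinv * (gen q (.D k) * x)) := by
  obtain ⟨c1, c2, c3, c4⟩ := (Uhat.relations q).comm hq
  refine ⟨?_, ?_, ?_, ?_, ?_, ?_, ?_, ?_⟩ <;> intros <;> rw [← mul_assoc]
  · rw [c1, smul_mul_assoc, mul_assoc]
  · rw [c2, smul_mul_assoc, mul_assoc]
  · rw [c3, smul_mul_assoc, mul_assoc]
  · rw [c4, smul_mul_assoc, mul_assoc]
  · rw [Uhat.D_E, mul_assoc]
  · rw [Uhat.D_F, mul_assoc]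
  · rw [← Uhat.K_D, mul_assoc]
  · rw [← Uhat.Kinv_D, mul_assoc]

theorem psi_rel12 {q s : ℂ} (h : IsGenericParam q s) :
    s • (psiI1 q * psiI2 q) - s⁻¹ • (psiI2 q * psiI1 q) = psiI3 q s := by
  obtain ⟨n1, n2, n3, n4, n5, n6, n7, n8⟩ := Uhat.normal_order q h.ne_zero
  have hs := h.s_ne_zero
  have hsq := h.sq
  simp only [psiI1, psiI2, psiI3, add_mul, mul_sub, sub_mul, smul_mul_assoc, mul_smul_comm,
    mul_assoc, n1, n2, n3, n4, ← Uhat.K_D, ← Uhat.Kinv_D, smul_smul, smul_sub]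
  have hd : s ^ 4 - 1 ≠ 0 := by
    intro h0
    apply h.not_root_of_unity 2 (by norm_num)
    rw [← hsq]
    linear_combination h0
  subst hsq
  match_scalars <;> field_simp <;> ring

theorem psi_rel31 {q s : ℂ} (h : IsGenericParam q s) :
    s • (psiI3 q s * psiI1 q) - s⁻¹ • (psiI1 q * psiI3 q s) = psiI2 q := by
  obtain ⟨n1, n2, n3, n4, n5, n6, n7, n8⟩ := Uhat.normal_order q h.ne_zero
  have hs := h.s_ne_zero
  have hsq := h.sq
  have hKL : ∀ x, Uhat.gen q .K * (Uhat.gen q .Kinv * x) = x := fun x => by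
    rw [← mul_assoc, (Uhat.relations q).K_Kinv, one_mul]
  have hLK : ∀ x, Uhat.gen q .Kinv * (Uhat.gen q .K * x) = x := fun x => by
    rw [← mul_assoc, (Uhat.relations q).Kinv_K, one_mul]
  simp only [psiI1, psiI2, psiI3, mul_add, add_mul, mul_sub, sub_mul, smul_mul_assoc,
    mul_smul_comm, mul_assoc, n1, n2, n3, n4, ← Uhat.K_D, ← Uhat.Kinv_D, smul_smul, smul_sub,
    smul_add, hKL, hLK]
  have hd : s ^ 4 - 1 ≠ 0 := by
    intro h0
    apply h.not_root_of_unity 2 (by norm_num)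
    rw [← hsq]
    linear_combination h0
  subst hsq
  match_scalars <;> field_simp <;> simp [Complex.I_sq] <;> ring

theorem psi_rel23 {q s : ℂ} (h : IsGenericParam q s) :
    s • (psiI2 q * psiI3 q s) - s⁻¹ • (psiI3 q s * psiI2 q) = psiI1 q := by
  obtain ⟨n1, n2, n3, n4, n5, n6, n7, n8⟩ := Uhat.normal_order q h.ne_zero
  have hs := h.s_ne_zero
  have hsq := h.sq
  have hq := h.ne_zero
  have hKL : ∀ x, Uhat.gen q .K * (Uhat.gen q .Kinv * x) = x := fun x => by
    rw [← mul_assoc, (Uhat.relations q).K_Kinv, one_mul]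
  have hLK : ∀ x, Uhat.gen q .Kinv * (Uhat.gen q .K * x) = x := fun x => by
    rw [← mul_assoc, (Uhat.relations q).Kinv_K, one_mul]
  have hE : ∀ x, Uhat.gen q .E * (Uhat.gen q .F * x) = Uhat.gen q .F * (Uhat.gen q .E * x) +
      (q - q⁻¹)⁻¹ • (Uhat.gen q .K * (Uhat.gen q .K * x) -
        Uhat.gen q .Kinv * (Uhat.gen q .Kinv * x)) := fun x => by
    have e := congrArg (· * x) (Uhat.relations q).E_F
    simp only [sub_mul, smul_mul_assoc, pow_two, mul_assoc] at e
    rw [← e]; abel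
  have hD0 : Uhat.gen q .K * Uhat.gen q (.D 0) = 1 - Uhat.gen q .Kinv * Uhat.gen q (.D 0) := by
    have e := Uhat.D_right q 0
    simp only [neg_zero, zpow_zero, one_smul, add_mul] at e
    rw [← e]; abel
  have hD1 : Uhat.gen q .K * (Uhat.gen q (.D 1) * Uhat.gen q (.D 0)) =
      q⁻¹ • Uhat.gen q (.D 0) -
        (q⁻¹ * q⁻¹) • (Uhat.gen q .Kinv * (Uhat.gen q (.D 1) * Uhat.gen q (.D 0))) := by
    have e := congrArg (· * Uhat.gen q (.D 0)) (Uhat.D_right q 1)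
    simp only [zpow_one, zpow_neg_one, add_mul, smul_mul_assoc, mul_assoc, one_mul] at e
    calc _ = q⁻¹ • (q • (Uhat.gen q .K * (Uhat.gen q (.D 1) * Uhat.gen q (.D 0))) +
          q⁻¹ • (Uhat.gen q .Kinv * (Uhat.gen q (.D 1) * Uhat.gen q (.D 0)))) -
          (q⁻¹ * q⁻¹) • (Uhat.gen q .Kinv * (Uhat.gen q (.D 1) * Uhat.gen q (.D 0))) := by
          match_scalars <;> field_simp <;> ring
      _ = _ := by rw [e]
  have hDm : Uhat.gen q .K * (Uhat.gen q (.D (-1)) * Uhat.gen q (.D 0)) =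
      q • Uhat.gen q (.D 0) -
        (q * q) • (Uhat.gen q .Kinv * (Uhat.gen q (.D (-1)) * Uhat.gen q (.D 0))) := by
    have e := congrArg (· * Uhat.gen q (.D 0)) (Uhat.D_right q (-1))
    simp only [zpow_one, zpow_neg_one, neg_neg, add_mul, smul_mul_assoc, mul_assoc, one_mul] at e
    calc _ = q • (q⁻¹ • (Uhat.gen q .K * (Uhat.gen q (.D (-1)) * Uhat.gen q (.D 0))) +
          q • (Uhat.gen q .Kinv * (Uhat.gen q (.D (-1)) * Uhat.gen q (.D 0)))) -
          (q * q) • (Uhat.gen q .Kinv * (Uhat.gen q (.D (-1)) * Uhat.gen q (.D 0))) := by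
          match_scalars <;> field_simp <;> ring
      _ = _ := by rw [e]
  simp only [psiI1, psiI2, psiI3, mul_add, add_mul, mul_sub, sub_mul, smul_mul_assoc,
    mul_smul_comm, mul_assoc, n1, n2, n3, n4, n5, n6, n7, n8, smul_smul, smul_sub,
    smul_add, zero_add, zero_sub, hD1, hDm]
  simp only [hE (Uhat.gen q (.D 0)), hD0, mul_sub, mul_one, hKL, smul_add, smul_sub, smul_smul]
  have hL : Uhat.gen q .Kinv * (Uhat.gen q .Kinv * Uhat.gen q (.D 0)) =
      Uhat.gen q .Kinv - Uhat.gen q (.D 0) := by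
    have e := congrArg (Uhat.gen q .Kinv * ·) hD0
    simp only [mul_sub, mul_one, hLK] at e
    rw [eq_sub_iff_add_eq, add_comm]
    exact eq_sub_iff_add_eq.mp e
  simp only [hL, smul_sub]
  have hd : s ^ 4 - 1 ≠ 0 := by
    intro h0
    apply h.not_root_of_unity 2 (by norm_num)
    rw [← hsq]
    linear_combination h0
  subst hsq
  match_scalars <;> field_simp <;> ring

/-- The homomorphism `ψ : U_q(so_3) → Û_q(sl_2)`. -/
def psi {q s : ℂ} (h : IsGenericParam q s) : Uso3 s →ₐ[ℂ] Uhat q :=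
  RingQuot.liftAlgHom ℂ
    ⟨FreeAlgebra.lift ℂ (fun g => match g with
      | .I1 => psiI1 q
      | .I2 => psiI2 q
      | .I3 => psiI3 q s), by
      intro x y hxy
      cases hxy
      · simpa using psi_rel12 h
      · simpa using psi_rel23 h
      · simpa using psi_rel31 h⟩

/-! ### Representations -/

/-- A representation of a complex algebra `A` on a complex vector space `V`. -/
abbrev Rep (A : Type*) [Ring A] [Algebra ℂ A] (V : Type*) [AddCommGroup V] [Module ℂ V] :=
  A →ₐ[ℂ] Module.End ℂ V

/-- Equivalence of representations: a linear isomorphism intertwining the two actions. -/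
def Rep.Equivalent {A : Type*} [Ring A] [Algebra ℂ A] {V W : Type*} [AddCommGroup V] [Module ℂ V]
    [AddCommGroup W] [Module ℂ W] (ρ : Rep A V) (σ : Rep A W) : Prop :=
  ∃ e : V ≃ₗ[ℂ] W, ∀ (a : A) (v : V), e (ρ a v) = σ a (e v)

/-- The direct sum of a family of representations. -/
def Rep.directSum {A : Type*} [Ring A] [Algebra ℂ A] {ι : Type*} {V : ι → Type*}
    [∀ i, AddCommGroup (V i)] [∀ i, Module ℂ (V i)] (ρ : ∀ i, Rep A (V i)) :
    Rep A (⨁ i, V i) :=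
  AlgHom.ofLinearMap
    { toFun := fun a => DirectSum.lmap fun i => (ρ i a : V i →ₗ[ℂ] V i)
      map_add' := fun a b => by ext; simp
      map_smul' := fun c a => by
        ext x i
        simp [DirectSum.smul_apply] }
    (by ext; simp)
    (fun a b => by ext; simp)

/-- The tensor product of two representations of `U_q(sl_2)`, formed with the comultiplication. -/
def Rep.tensor {q : ℂ} (hq : q ≠ 0) {V W : Type*} [AddCommGroup V] [Module ℂ V]
    [AddCommGroup W] [Module ℂ W] (T : Rep (Usl2 q) V) (T' : Rep (Usl2 q) W) :
    Rep (Usl2 q) (V ⊗[ℂ] W) :=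
  ((Module.endTensorEndAlgHom (R := ℂ) (A := ℂ) (M := V) (N := W)).comp
    (Algebra.TensorProduct.map T T')).comp (Usl2.comul q hq)

/-- The operator `q^k T(q^H) + q^{-k} T(q^{-H})`. -/
def Rep.shifted {q : ℂ} {V : Type*} [AddCommGroup V] [Module ℂ V] (T : Rep (Usl2 q) V) (k : ℤ) :
    Module.End ℂ V :=
  q ^ k • T (Usl2.gen q .K) + q ^ (-k) • T (Usl2.gen q .Kinv)

/-- A representation `T` of `U_q(sl_2)` can be extended to `Û_q(sl_2)` when all the operators
`q^k T(q^H) + q^{-k} T(q^{-H})`, `k ∈ ℤ`, are invertible. -/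
def Rep.Extendable {q : ℂ} {V : Type*} [AddCommGroup V] [Module ℂ V] (T : Rep (Usl2 q) V) : Prop :=
  ∀ k : ℤ, IsUnit (T.shifted k)

theorem Rep.relations {q : ℂ} {V : Type*} [AddCommGroup V] [Module ℂ V] (T : Rep (Usl2 q) V) :
    Sl2Relations q (T (Usl2.gen q .K)) (T (Usl2.gen q .Kinv)) (T (Usl2.gen q .E))
      (T (Usl2.gen q .F)) := by
  have h := Usl2.relations q
  constructor
  · rw [← map_mul, h.K_Kinv, map_one]
  · rw [← map_mul, h.Kinv_K, map_one]
  · rw [← map_mul, ← map_mul, h.K_E, map_smul]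
  · rw [← map_mul, ← map_mul, h.K_F, map_smul]
  · rw [← map_mul, ← map_mul, ← map_sub, h.E_F, map_smul, map_sub, map_pow, map_pow]

/-- If `a x = x b` with `a`, `b` invertible then `a^{-1} x = x b^{-1}`. -/
theorem inverse_comm {A : Type*} [Ring A] {a b x : A} (ha : IsUnit a) (hb : IsUnit b)
    (h : a * x = x * b) : Ring.inverse a * x = x * Ring.inverse b := by
  calc Ring.inverse a * x = Ring.inverse a * (x * b) * Ring.inverse b := by
        rw [mul_assoc, mul_assoc, Ring.mul_inverse_cancel _ hb, mul_one]
    _ = x * Ring.inverse b := by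
        rw [← h, ← mul_assoc, Ring.inverse_mul_cancel _ ha, one_mul]

/-- The extension of a representation `T` of `U_q(sl_2)` to `Û_q(sl_2)`, given by
`T((q^k q^H + q^{-k} q^{-H})^{-1}) = (q^k T(q^H) + q^{-k} T(q^{-H}))^{-1}`. -/
def Rep.extend {q : ℂ} (hq : q ≠ 0) {V : Type*} [AddCommGroup V] [Module ℂ V] (T : Rep (Usl2 q) V)
    (hT : T.Extendable) : Rep (Uhat q) V :=
  RingQuot.liftAlgHom ℂ
    ⟨FreeAlgebra.lift ℂ (fun g => match g with
      | .K => T (Usl2.gen q .K)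
      | .Kinv => T (Usl2.gen q .Kinv)
      | .E => T (Usl2.gen q .E)
      | .F => T (Usl2.gen q .F)
      | .D k => Ring.inverse (T.shifted k)), by
      have h := T.relations
      obtain ⟨c1, c2, c3, c4⟩ := h.comm hq
      intro x y hxy
      cases hxy with
      | K_Kinv => simpa using h.K_Kinv
      | Kinv_K => simpa using h.Kinv_K
      | K_E => simpa using h.K_E
      | K_F => simpa using h.K_F
      | E_F => simpa using h.E_F
      | D_left k => simpa [Rep.shifted] using Ring.inverse_mul_cancel _ (hT k)
      | D_right k => simpa [Rep.shifted] using Ring.mul_inverse_cancel _ (hT k)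
      | K_D k =>
        simp only [map_mul, FreeAlgebra.lift_ι_apply]
        refine (inverse_comm (hT k) (hT k) ?_).symm
        simp [Rep.shifted, mul_add, add_mul, h.K_Kinv, h.Kinv_K]
      | Kinv_D k =>
        simp only [map_mul, FreeAlgebra.lift_ι_apply]
        refine (inverse_comm (hT k) (hT k) ?_).symm
        simp [Rep.shifted, mul_add, add_mul, h.K_Kinv, h.Kinv_K]
      | D_E k =>
        simp only [map_mul, FreeAlgebra.lift_ι_apply]
        refine inverse_comm (hT k) (hT (k + 1)) ?_
        simp only [Rep.shifted, mul_add, add_mul, smul_mul_assoc, mul_smul_comm, c1, c3, smul_smul]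
        rw [zpow_add₀ hq, neg_add, zpow_add₀ hq, zpow_one, zpow_neg_one]
      | D_F k =>
        simp only [map_mul, FreeAlgebra.lift_ι_apply]
        refine inverse_comm (hT k) (hT (k - 1)) ?_
        simp only [Rep.shifted, mul_add, add_mul, smul_mul_assoc, mul_smul_comm, c2, c4, smul_smul]
        rw [zpow_sub₀ hq, neg_sub, sub_eq_neg_add, zpow_add₀ hq, zpow_one, div_eq_mul_inv]⟩

/-- The representation `R = T ∘ ψ` of `U_q(so_3)` obtained from a representation `T` of `U_q(sl_2)`
which extends to `Û_q(sl_2)`. -/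
def Rep.compPsi {q s : ℂ} (h : IsGenericParam q s) {V : Type*} [AddCommGroup V] [Module ℂ V]
    (T : Rep (Usl2 q) V) (hT : T.Extendable) : Rep (Uso3 s) V :=
  (T.extend h.ne_zero hT).comp (psi h)

/-! ### The representations `T_l^{(1)}`, `T_l^{(±i)}` of `U_q(sl_2)`

The spin `l = 0, 1/2, 1, ...` is encoded by the natural number `n = 2l`. -/

/-- The space of spin `l = n/2`.  Its basis vector number `i = 0, ..., n` is `|m⟩`
with `m = i - l`. -/
abbrev Space (n : ℕ) : Type := Fin (n + 1) → ℂ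

/-- The vector `|m⟩`, `m = k - l`, of the space of spin `l = n/2`; it is `0` if `k` is out of the
range `0, ..., n`. -/
def ket (n : ℕ) (k : ℤ) : Space n := fun j => if (j : ℤ) = k then 1 else 0

/-- The `q`-number `[a] = (q^a - q^{-a}) / (q - q^{-1})`. -/
def qnum (q : ℂ) (a : ℤ) : ℂ := (q ^ a - q ^ (-a)) / (q - q⁻¹)

/-- The operator with `|m⟩ ↦ c q^m |m⟩`, where `2m = 2i - n`. -/
def opK (s c : ℂ) (n : ℕ) : Module.End ℂ (Space n) :=
  (Pi.basisFun ℂ (Fin (n + 1))).constr ℂ fun i => (c * s ^ (2 * (i : ℤ) - n)) • ket n i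

/-- The operator with `|m⟩ ↦ [l - m] |m + 1⟩`, where `l - m = n - i`. -/
def opE (q : ℂ) (n : ℕ) : Module.End ℂ (Space n) :=
  (Pi.basisFun ℂ (Fin (n + 1))).constr ℂ fun i => qnum q (n - i) • ket n (i + 1)

/-- The operator with `|m⟩ ↦ [l + m] |m - 1⟩`, where `l + m = i`. -/
def opF (q : ℂ) (n : ℕ) : Module.End ℂ (Space n) :=
  (Pi.basisFun ℂ (Fin (n + 1))).constr ℂ fun i => qnum q i • ket n (i - 1)

theorem ket_eq (n : ℕ) (i : Fin (n + 1)) : ket n i = Pi.basisFun ℂ (Fin (n + 1)) i := by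
  ext j
  simp [ket, Pi.single_apply, Fin.ext_iff]

theorem opK_ket (s c : ℂ) (n : ℕ) (i : Fin (n + 1)) :
    opK s c n (ket n i) = (c * s ^ (2 * (i : ℤ) - n)) • ket n i := by
  rw [ket_eq, opK, Module.Basis.constr_basis, ket_eq]

theorem opE_ket (q : ℂ) (n : ℕ) (k : ℤ) (h0 : 0 ≤ k) (hn : k ≤ n) :
    opE q n (ket n k) = qnum q (n - k) • ket n (k + 1) := by
  lift k to ℕ using h0
  have := ket_eq n ⟨k, by omega⟩
  dsimp only at this
  rw [this, opE, Module.Basis.constr_basis]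

theorem opF_ket (q : ℂ) (n : ℕ) (k : ℤ) (h0 : 0 ≤ k) (hn : k ≤ n) :
    opF q n (ket n k) = qnum q k • ket n (k - 1) := by
  lift k to ℕ using h0
  have := ket_eq n ⟨k, by omega⟩
  dsimp only at this
  rw [this, opF, Module.Basis.constr_basis]

theorem ket_out (n : ℕ) (k : ℤ) (h : k < 0 ∨ (n : ℤ) < k) : ket n k = 0 := by
  ext j
  have := j.2
  simp only [ket, Pi.zero_apply, ite_eq_right_iff, one_ne_zero, imp_false]
  omega

theorem opK_ket' (s c : ℂ) (n : ℕ) (k : ℤ) :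
    opK s c n (ket n k) = (c * s ^ (2 * k - n)) • ket n k := by
  by_cases hk : k < 0 ∨ (n : ℤ) < k
  · simp [ket_out n k hk]
  · have h0 : 0 ≤ k := by omega
    lift k to ℕ using h0
    exact opK_ket s c n ⟨k, by omega⟩

theorem opE_opF_ket (q : ℂ) (n : ℕ) (i : Fin (n + 1)) :
    opE q n (opF q n (ket n i)) = (qnum q i * qnum q (n - i + 1)) • ket n i := by
  have := i.2
  rw [opF_ket q n i (by omega) (by omega), map_smul]
  by_cases hi : (i : ℕ) = 0
  · simp [hi, qnum]
  · rw [opE_ket q n _ (by omega) (by omega), smul_smul, sub_add_cancel, sub_sub_eq_add_sub,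
      add_sub_right_comm]

theorem opF_opE_ket (q : ℂ) (n : ℕ) (i : Fin (n + 1)) :
    opF q n (opE q n (ket n i)) = (qnum q (n - i) * qnum q (i + 1)) • ket n i := by
  have := i.2
  rw [opE_ket q n i (by omega) (by omega), map_smul]
  by_cases hi : (i : ℕ) = n
  · simp [hi, qnum]
  · rw [opF_ket q n _ (by omega) (by omega), smul_smul, add_sub_cancel_right]

theorem ket_hom_ext {n : ℕ} {f g : Module.End ℂ (Space n)}
    (h : ∀ i : Fin (n + 1), f (ket n i) = g (ket n i)) : f = g :=
  (Pi.basisFun ℂ (Fin (n + 1))).ext fun i => by simpa only [← ket_eq] using h i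

theorem opK_relations {q s c : ℂ} (h : IsGenericParam q s) (hc : c ^ 4 = 1) (n : ℕ) :
    Sl2Relations q (opK s c n) (opK s⁻¹ c⁻¹ n) (opE q n) (c ^ 2 • opF q n) := by
  have hs := h.s_ne_zero
  have hq := h.ne_zero
  have hd := h.sub_inv_ne_zero
  have hc0 : c ≠ 0 := by rintro rfl; norm_num at hc
  have hsq : ∀ k : ℤ, s ^ (2 * k) = q ^ k := fun k => by
    rw [zpow_mul, ← h.sq]; norm_cast
  constructor
  · refine ket_hom_ext fun i => ?_
    simp only [Module.End.mul_apply, opK_ket, map_smul, smul_smul, Module.End.one_apply]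
    rw [inv_zpow, mul_mul_mul_comm, inv_mul_cancel₀ hc0, inv_mul_cancel₀ (zpow_ne_zero _ hs),
      one_mul, one_smul]
  · refine ket_hom_ext fun i => ?_
    simp only [Module.End.mul_apply, opK_ket, map_smul, smul_smul, Module.End.one_apply]
    rw [inv_zpow, mul_mul_mul_comm, mul_inv_cancel₀ hc0, mul_inv_cancel₀ (zpow_ne_zero _ hs),
      one_mul, one_smul]
  · refine ket_hom_ext fun i => ?_
    have := i.2
    simp only [Module.End.mul_apply, LinearMap.smul_apply, opK_ket', map_smul, smul_smul,
      opE_ket q n i (by omega) (by omega)]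
    congr 1
    rw [inv_zpow, mul_add, add_sub_right_comm, zpow_add₀ hs (2 * (i : ℤ) - n), hsq 1, zpow_one]
    have := zpow_ne_zero (2 * (i : ℤ) - n) hs
    field_simp
  · refine ket_hom_ext fun i => ?_
    have := i.2
    simp only [Module.End.mul_apply, LinearMap.smul_apply, opK_ket', map_smul, smul_smul,
      opF_ket q n i (by omega) (by omega)]
    congr 1
    rw [inv_zpow, mul_sub, sub_right_comm, zpow_sub₀ hs (2 * (i : ℤ) - n), hsq 1, zpow_one]
    have := zpow_ne_zero (2 * (i : ℤ) - n) hs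
    field_simp
  · refine ket_hom_ext fun i => ?_
    simp only [Module.End.mul_apply, LinearMap.smul_apply, LinearMap.sub_apply, opK_ket, map_smul,
      smul_smul, opE_opF_ket, opF_opE_ket, pow_two, ← sub_smul]
    congr 1
    have e : ∀ a : ℂ, ∀ k : ℤ, a * s ^ k * (a * s ^ k) = a ^ 2 * q ^ k := fun a k => by
      rw [← hsq, mul_comm 2 k, zpow_mul, zpow_ofNat]; ring
    have e' : ∀ a : ℂ, ∀ k : ℤ, a * s⁻¹ ^ k * (a * s⁻¹ ^ k) = a ^ 2 * (q ^ k)⁻¹ := fun a k => by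
      rw [← hsq, mul_comm 2 k, zpow_mul, zpow_ofNat, inv_zpow]; ring
    have hcc : c⁻¹ ^ 2 = c ^ 2 := by
      field_simp
      linear_combination -hc
    rw [e, e', hcc]
    simp only [qnum, neg_sub, neg_add, zpow_add₀ hq, zpow_sub₀ hq, zpow_neg, zpow_one,
      two_mul]
    have hi := zpow_ne_zero (i : ℤ) hq
    have hn := zpow_ne_zero (n : ℤ) hq
    generalize q ^ (i : ℤ) = x at *
    generalize q ^ (n : ℤ) = y at *
    have hd' : q ^ 2 - 1 ≠ 0 := fun h0 =>
      h.not_root_of_unity 2 (by norm_num) (by linear_combination h0)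
    field_simp
    ring

/-- For a fourth root of unity `c ∈ {1, -1, i, -i}` and a spin `l = n/2`, the representation
`T_l^{(c)}` of `U_q(sl_2)`:
`q^H |m⟩ = c q^m |m⟩`, `E |m⟩ = [l - m] |m + 1⟩`, `F |m⟩ = c^2 [l + m] |m - 1⟩`
(so the sign `c^2` is `1` for `c = ±1` and `-1` for `c = ±i`). -/
def T {q s : ℂ} (h : IsGenericParam q s) (c : ℂ) (hc : c ^ 4 = 1) (n : ℕ) :
    Rep (Usl2 q) (Space n) :=
  Usl2.lift (opK_relations h hc n)

/-- `T_l^{(1)}`, `l = n/2`. -/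
def T1 {q s : ℂ} (h : IsGenericParam q s) (n : ℕ) : Rep (Usl2 q) (Space n) :=
  T h 1 (by norm_num) n

theorem unit_I_pow_four (ω : ℤˣ) : (((ω : ℤ) : ℂ) * Complex.I) ^ 4 = 1 := by
  rcases Int.units_eq_one_or ω with rfl | rfl <;> simp [Even.neg_pow (by decide : Even 4)]

/-- `T_l^{(ωi)}`, `l = n/2`, for a sign `ω = ±1`. -/
def Ti {q s : ℂ} (h : IsGenericParam q s) (ω : ℤˣ) (n : ℕ) : Rep (Usl2 q) (Space n) :=
  T h (((ω : ℤ) : ℂ) * Complex.I) (unit_I_pow_four ω) n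

theorem isUnit_of_diagonal {ι V : Type*} [AddCommGroup V] [Module ℂ V] (b : Module.Basis ι ℂ V)
    (f : Module.End ℂ V) (a : ι → ℂ) (ha : ∀ i, a i ≠ 0) (hf : ∀ i, f (b i) = a i • b i) :
    IsUnit f := by
  refine isUnit_iff_exists.2 ⟨b.constr ℂ fun i => (a i)⁻¹ • b i, ?_, ?_⟩ <;>
    refine b.ext fun i => ?_ <;> simp [hf, ha, smul_smul]

theorem IsGenericParam.zpow_eq_one {q s : ℂ} (h : IsGenericParam q s) {m : ℤ} (hm : q ^ m = 1) :
    m = 0 := by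
  by_contra h0
  apply h.not_root_of_unity m.natAbs (by omega)
  rcases Int.natAbs_eq m with e | e
  · rw [e] at hm
    exact_mod_cast hm
  · rw [e, zpow_neg, inv_eq_one] at hm
    exact_mod_cast hm

theorem IsGenericParam.eigenvalue_ne_zero {q s : ℂ} (h : IsGenericParam q s) {c : ℂ} {e : ℤ}
    (hc : c ^ 2 = 1 ∨ (c ^ 2 = -1 ∧ Odd e)) (k : ℤ) :
    q ^ k * (c * s ^ e) + q ^ (-k) * (c⁻¹ * s⁻¹ ^ e) ≠ 0 := by
  have hs := zpow_ne_zero e h.s_ne_zero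
  have hq := zpow_ne_zero k h.ne_zero
  have hc0 : c ≠ 0 := by
    rintro rfl
    norm_num at hc
  intro h0
  have h1 : c ^ 2 * q ^ (2 * k + e) = -1 := by
    have e1 : q ^ (2 * k + e) = (q ^ k) ^ 2 * (s ^ e) ^ 2 := by
      have e2 : q ^ e = (s ^ e) ^ 2 := by
        rw [← h.sq, ← zpow_natCast, ← zpow_natCast, ← zpow_mul, ← zpow_mul, mul_comm]
      rw [zpow_add₀ h.ne_zero, mul_comm 2 k, zpow_mul, zpow_ofNat, e2]
    rw [e1]
    rw [zpow_neg, inv_zpow] at h0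
    field_simp at h0
    linear_combination h0
  rcases hc with hc | ⟨hc, ho⟩
  · rw [hc, one_mul] at h1
    have h2 : q ^ ((2 * k + e) * 2) = 1 := by
      rw [zpow_mul, h1]; norm_num
    have h3 := h.zpow_eq_one h2
    have h4 : 2 * k + e = 0 := by omega
    rw [h4, zpow_zero] at h1
    norm_num at h1
  · rw [hc, neg_one_mul, neg_inj] at h1
    have h3 := h.zpow_eq_one h1
    obtain ⟨r, hr⟩ := ho
    omega

theorem T_extendable {q s : ℂ} (h : IsGenericParam q s) (c : ℂ) (hc : c ^ 4 = 1) (n : ℕ)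
    (hc' : c ^ 2 = 1 ∨ (c ^ 2 = -1 ∧ Odd n)) : (T h c hc n).Extendable := by
  intro k
  refine isUnit_of_diagonal (Pi.basisFun ℂ (Fin (n + 1))) _
    (fun i => q ^ k * (c * s ^ (2 * (i : ℤ) - n)) +
      q ^ (-k) * (c⁻¹ * s⁻¹ ^ (2 * (i : ℤ) - n))) (fun i => ?_) (fun i => ?_)
  · refine h.eigenvalue_ne_zero (hc'.imp_right fun ⟨h1, h2⟩ => ⟨h1, ?_⟩) k
    obtain ⟨r, hr⟩ := h2
    exact ⟨(i : ℤ) - r - 1, by omega⟩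
  · rw [← ket_eq, Rep.shifted, LinearMap.add_apply, LinearMap.smul_apply, LinearMap.smul_apply]
    have e1 : T h c hc n (Usl2.gen q .K) = opK s c n := by
      simp [T, Usl2.lift, Usl2.gen]
    have e2 : T h c hc n (Usl2.gen q .Kinv) = opK s⁻¹ c⁻¹ n := by
      simp [T, Usl2.lift, Usl2.gen]
    rw [e1, e2, opK_ket, opK_ket, smul_smul, smul_smul, ← add_smul]

theorem T1_extendable {q s : ℂ} (h : IsGenericParam q s) (n : ℕ) : (T1 h n).Extendable :=
  T_extendable h 1 _ n (Or.inl (one_pow 2))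

theorem Ti_extendable {q s : ℂ} (h : IsGenericParam q s) (ω : ℤˣ) {n : ℕ} (hn : Odd n) :
    (Ti h ω n).Extendable := by
  refine T_extendable h _ _ n (Or.inr ⟨?_, hn⟩)
  rcases Int.units_eq_one_or ω with rfl | rfl <;> simp

/-! ### The representations `R_l^{(1)}`, `R_l^{(±i)}` of `U_q(so_3)` and their tensor products -/

/-- `R_l^{(1)} = T_l^{(1)} ∘ ψ`, `l = n/2`. -/
def R1 {q s : ℂ} (h : IsGenericParam q s) (n : ℕ) : Rep (Uso3 s) (Space n) :=
  (T1 h n).compPsi h (T1_extendable h n)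

/-- `R_l^{(ωi)} = T_l^{(ωi)} ∘ ψ`, `l = n/2`, for a sign `ω = ±1`; here `l` is half of an odd
number. -/
def Ri {q s : ℂ} (h : IsGenericParam q s) (ω : ℤˣ) (n : ℕ) (hn : Odd n) : Rep (Uso3 s) (Space n) :=
  (Ti h ω n).compPsi h (Ti_extendable h ω hn)

/-- The tensor product `R ⊗ R' = (T ⊗ T') ∘ ψ` of the representations `R = T ∘ ψ`, `R' = T' ∘ ψ`
of `U_q(so_3)`.  It is defined when `T ⊗ T'` extends to `Û_q(sl_2)`. -/
def tensorSo3 {q s : ℂ} (h : IsGenericParam q s) {V W : Type*} [AddCommGroup V] [Module ℂ V]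
    [AddCommGroup W] [Module ℂ W] (T : Rep (Usl2 q) V) (T' : Rep (Usl2 q) W)
    (hT : (T.tensor h.ne_zero T').Extendable) : Rep (Uso3 s) (V ⊗[ℂ] W) :=
  (T.tensor h.ne_zero T').compPsi h hT

/-- The doubled spins `2j` for `j = l + l', l + l' - 1, ..., |l - l'|`, where `l = n/2`,
`l' = n'/2`. -/
def cgSpin (n n' : ℕ) (k : Fin (min n n' + 1)) : ℕ := n + n' - 2 * (k : ℕ)

theorem cgSpin_odd {n n' : ℕ} (h : Odd (n + n')) (k : Fin (min n n' + 1)) :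
    Odd (cgSpin n n' k) := by
  have := k.2
  unfold cgSpin
  obtain ⟨r, hr⟩ := h
  exact ⟨r - k, by omega⟩

end QSo3

end

/-!
Every element of `U_q(so_3)` acts through `ψ`, so a linear map that intertwines two extendable
representations of `U_q(sl_2)` also intertwines the associated representations of `U_q(so_3)`
(`Rep.compPsi_intertwines`); the decompositions are therefore proved for `U_q(sl_2)` first.

For fourth roots of unity `c`, `c'`, the representation `T_l^{(c)} ⊗ T_{l'}^{(c')}` is the direct
sum of the `T_j^{(c c')}`, `|l - l'| ≤ j ≤ l + l'` (`exists_clebschGordan`). For each `j` the tensor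
product contains a highest weight vector of weight `c c' q^j` (`exists_highestWeight_tensor`). As
`q` is not a root of unity, a highest weight vector in a finite-dimensional representation is the
image of `|j⟩` under an intertwining operator from `T_j^{(c c')}`
(`exists_intertwiner_of_highestWeight`). The resulting map from the direct sum commutes with the
nilpotent operator `E`. It is injective on the kernel of `E`, because the highest weight vectors have
distinct weights; hence it is injective, and it is bijective because the dimensions agree.

The operator `q^H` is diagonal on the tensor product, with eigenvalues `c c' q^m` where
`m ∈ l + l' + ℤ`. On such an eigenspace some `q^k q^H + q^{-k} q^{-H}` vanishes exactly if
`(c c')^2 q^{2(m+k)} = -1`, which happens only for `c c' = ±i` and `m = -k`. This decides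
extendability.

For `c = ωi`, `c' = ω'i` the product `c c'` can be `-1`. Passing from `T_j^{(1)}` to `T_j^{(-1)}`
changes the signs of `I_1` and `I_2`, and conjugation by `|m⟩ ↦ |-m⟩` undoes this
(`compPsi_neg_one_equivalent`).
-/

namespace QSo3

/-! ### Intertwining operators -/

/-- A linear map that intertwines the images of the generators of a quotient of a free algebra
intertwines the whole actions. -/
theorem Rep.intertwines_of_generators {X : Type*} {r : FreeAlgebra ℂ X → FreeAlgebra ℂ X → Prop}
    {V W : Type*} [AddCommGroup V] [Module ℂ V] [AddCommGroup W] [Module ℂ W]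
    {ρ : Rep (RingQuot r) V} {σ : Rep (RingQuot r) W} {f : V →ₗ[ℂ] W}
    (hf : ∀ g v, f (ρ (RingQuot.mkAlgHom ℂ r (FreeAlgebra.ι ℂ g)) v) =
      σ (RingQuot.mkAlgHom ℂ r (FreeAlgebra.ι ℂ g)) (f v)) (a : RingQuot r) (v : V) :
    f (ρ a v) = σ a (f v) := by
  obtain ⟨a, rfl⟩ := RingQuot.mkAlgHom_surjective ℂ r a
  induction a generalizing v with
  | grade0 z => simp [Algebra.algebraMap_eq_smul_one]
  | grade1 g => exact hf g v
  | mul a b ha hb => simp [ha, hb]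
  | add a b ha hb => simp [ha, hb]

theorem Rep.shifted_intertwines {q : ℂ} {V W : Type*} [AddCommGroup V]
    [Module ℂ V] [AddCommGroup W] [Module ℂ W] {T : Rep (Usl2 q) V} {T' : Rep (Usl2 q) W}
    {f : V →ₗ[ℂ] W} (hf : ∀ g v, f (T (Usl2.gen q g) v) = T' (Usl2.gen q g) (f v)) (k : ℤ)
    (v : V) : f (T.shifted k v) = T'.shifted k (f v) := by
  simp [Rep.shifted, hf]

/-- An operator intertwining two operators intertwines their inverses. -/
theorem ringInverse_intertwines {V W : Type*} [AddCommGroup V] [Module ℂ V] [AddCommGroup W]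
    [Module ℂ W] {f : V →ₗ[ℂ] W} {a : Module.End ℂ V} {b : Module.End ℂ W} (ha : IsUnit a)
    (hb : IsUnit b) (h : ∀ v, f (a v) = b (f v)) (v : V) :
    f (Ring.inverse a v) = Ring.inverse b (f v) := by
  have h1 : a (Ring.inverse a v) = v := by
    rw [← Module.End.mul_apply, Ring.mul_inverse_cancel _ ha, Module.End.one_apply]
  conv_rhs => rw [← h1, h, ← Module.End.mul_apply, Ring.inverse_mul_cancel _ hb,
    Module.End.one_apply]

section extend

variable {q : ℂ} (hq : q ≠ 0) {V : Type*} [AddCommGroup V] [Module ℂ V]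
  (T : Rep (Usl2 q) V) (hT : T.Extendable)

theorem Rep.extend_K : T.extend hq hT (Uhat.gen q .K) = T (Usl2.gen q .K) := by
  simp [Rep.extend, Uhat.gen]

theorem Rep.extend_Kinv : T.extend hq hT (Uhat.gen q .Kinv) = T (Usl2.gen q .Kinv) := by
  simp [Rep.extend, Uhat.gen]

theorem Rep.extend_E : T.extend hq hT (Uhat.gen q .E) = T (Usl2.gen q .E) := by
  simp [Rep.extend, Uhat.gen]

theorem Rep.extend_F : T.extend hq hT (Uhat.gen q .F) = T (Usl2.gen q .F) := by
  simp [Rep.extend, Uhat.gen]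

theorem Rep.extend_D (k : ℤ) :
    T.extend hq hT (Uhat.gen q (.D k)) = Ring.inverse (T.shifted k) := by
  simp [Rep.extend, Uhat.gen]

end extend

/-- An operator intertwining two extendable representations of `U_q(sl_2)` intertwines the
corresponding representations of `U_q(so_3)`. -/
theorem Rep.compPsi_intertwines {q s : ℂ} (h : IsGenericParam q s) {V W : Type*} [AddCommGroup V]
    [Module ℂ V] [AddCommGroup W] [Module ℂ W] {T : Rep (Usl2 q) V} {T' : Rep (Usl2 q) W}
    (hT : T.Extendable) (hT' : T'.Extendable)
    {f : V →ₗ[ℂ] W} (hf : ∀ g v, f (T (Usl2.gen q g) v) = T' (Usl2.gen q g) (f v))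
    (a : Uso3 s) (v : V) : f (T.compPsi h hT a v) = T'.compPsi h hT' a (f v) := by
  refine Rep.intertwines_of_generators (fun g v => ?_) (psi h a) v
  change f (T.extend h.ne_zero hT (Uhat.gen q g) v) = T'.extend h.ne_zero hT' (Uhat.gen q g) (f v)
  cases g with
  | K => simp only [Rep.extend_K, hf]
  | Kinv => simp only [Rep.extend_Kinv, hf]
  | E => simp only [Rep.extend_E, hf]
  | F => simp only [Rep.extend_F, hf]
  | D k =>
    simp only [Rep.extend_D]
    exact ringInverse_intertwines (hT k) (hT' k) (Rep.shifted_intertwines hf k) v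

theorem Rep.directSum_of {A : Type*} [Ring A] [Algebra ℂ A] {ι : Type*} [DecidableEq ι]
    {V : ι → Type*} [∀ i, AddCommGroup (V i)] [∀ i, Module ℂ (V i)] (ρ : ∀ i, Rep A (V i)) (a : A)
    (i : ι) (v : V i) : Rep.directSum ρ a (DirectSum.lof ℂ ι V i v) =
      DirectSum.lof ℂ ι V i (ρ i a v) := by
  simp [Rep.directSum]

/-- If intertwining operators `φ i : V i → W` induce a bijection `⨁ V i → W`, then the
representation on `W` is equivalent to the direct sum. -/
theorem Rep.equivalent_directSum {A : Type*} [Ring A] [Algebra ℂ A] {ι : Type*} [DecidableEq ι]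
    {V : ι → Type*} [∀ i, AddCommGroup (V i)] [∀ i, Module ℂ (V i)] {W : Type*} [AddCommGroup W]
    [Module ℂ W] (ρ : ∀ i, Rep A (V i)) (σ : Rep A W) (φ : ∀ i, V i →ₗ[ℂ] W)
    (hφ : ∀ i a v, φ i (ρ i a v) = σ a (φ i v))
    (hbij : Function.Bijective (DirectSum.toModule ℂ ι W φ)) :
    σ.Equivalent (Rep.directSum ρ) := by
  let e := LinearEquiv.ofBijective _ hbij
  refine ⟨e.symm, fun a w => ?_⟩
  obtain ⟨x, rfl⟩ := e.surjective w
  rw [LinearEquiv.symm_apply_eq, LinearEquiv.symm_apply_apply]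
  change (σ a ∘ₗ e.toLinearMap) x = (e.toLinearMap ∘ₗ Rep.directSum ρ a) x
  congr 1
  refine DirectSum.linearMap_ext ℂ fun i => LinearMap.ext fun v => ?_
  simp [e, Rep.directSum_of, hφ]

theorem Rep.Equivalent.trans {A : Type*} [Ring A] [Algebra ℂ A] {U V W : Type*} [AddCommGroup U]
    [Module ℂ U] [AddCommGroup V] [Module ℂ V] [AddCommGroup W] [Module ℂ W] {ρ : Rep A U}
    {σ : Rep A V} {τ : Rep A W} (h₁ : ρ.Equivalent σ) (h₂ : σ.Equivalent τ) :
    ρ.Equivalent τ := by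
  obtain ⟨e, he⟩ := h₁
  obtain ⟨f, hf⟩ := h₂
  exact ⟨e.trans f, fun a v => by simp [he, hf]⟩

theorem Rep.Equivalent.directSum_congr {A : Type*} [Ring A] [Algebra ℂ A] {ι : Type*}
    {V W : ι → Type*} [∀ i, AddCommGroup (V i)] [∀ i, Module ℂ (V i)]
    [∀ i, AddCommGroup (W i)] [∀ i, Module ℂ (W i)] {ρ : ∀ i, Rep A (V i)} {σ : ∀ i, Rep A (W i)}
    (h : ∀ i, (ρ i).Equivalent (σ i)) : (Rep.directSum ρ).Equivalent (Rep.directSum σ) := by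
  classical
  choose e he using h
  refine ⟨DFinsupp.mapRange.linearEquiv e, fun a x => ?_⟩
  refine DFinsupp.ext fun i => ?_
  have h1 : (Rep.directSum ρ a x) i = ρ i a (x i) := by
    simp [Rep.directSum]
  have h2 : ∀ y, (Rep.directSum σ a y) i = σ i a (y i) := fun y => by
    simp [Rep.directSum]
  refine Eq.trans ?_ (h2 _).symm
  change e i ((Rep.directSum ρ a x) i) = σ i a (e i (x i))
  rw [h1, he]

/-! ### Highest weight vectors generate copies of the `T_l` -/

theorem qnum_zero (q : ℂ) : qnum q 0 = 0 := by simp [qnum]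

theorem IsGenericParam.qnum_ne_zero {q s : ℂ} (h : IsGenericParam q s) {m : ℤ} (hm : m ≠ 0) :
    qnum q m ≠ 0 := by
  refine div_ne_zero (fun h0 => ?_) h.sub_inv_ne_zero
  have h1 : q ^ (m * 2) = 1 := by
    have h2 := sub_eq_zero.1 h0
    rw [mul_two, zpow_add₀ h.ne_zero]
    nth_rewrite 2 [h2]
    rw [← zpow_add₀ h.ne_zero, add_neg_cancel, zpow_zero]
  have := h.zpow_eq_one h1
  omega

theorem IsGenericParam.qnum_mul_succ {q s : ℂ} (h : IsGenericParam q s) (r j : ℤ) :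
    qnum q r * qnum q (j - r + 1) + qnum q (j - 2 * r) = qnum q (r + 1) * qnum q (j - r) := by
  have hq := h.ne_zero
  simp only [qnum, neg_sub, neg_add, zpow_add₀ hq, zpow_sub₀ hq, zpow_neg, zpow_one, two_mul]
  have hi := zpow_ne_zero r hq
  have hn := zpow_ne_zero j hq
  generalize q ^ r = x at *
  generalize q ^ j = y at *
  have hd' : q ^ 2 - 1 ≠ 0 := fun h0 =>
    h.not_root_of_unity 2 (by norm_num) (by linear_combination h0)
  field_simp
  ring

section highestWeight

variable {q s c : ℂ} {V : Type*} [AddCommGroup V] [Module ℂ V] {K L E F : Module.End ℂ V} {v : V}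
  {j : ℕ}

theorem Sl2Relations.K_pow_F (hR : Sl2Relations q K L E F) (h : IsGenericParam q s)
    (hK : K v = (c * s ^ (j : ℤ)) • v) (r : ℕ) :
    K ((F ^ r) v) = (c * s ^ ((j : ℤ) - 2 * r)) • (F ^ r) v := by
  induction r with
  | zero => simp [hK]
  | succ r ih =>
    have e := LinearMap.congr_fun (hR.comm h.ne_zero).2.1 ((F ^ r) v)
    simp only [Module.End.mul_apply, LinearMap.smul_apply] at e
    rw [pow_succ', Module.End.mul_apply, e, ih, map_smul, smul_smul]
    congr 1
    have e3 : (j : ℤ) - 2 * r = (j - 2 * (r + 1 : ℕ)) + 2 := by push_cast; ring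
    rw [e3, zpow_add₀ h.s_ne_zero, zpow_ofNat, h.sq]
    have := h.ne_zero
    field_simp

theorem Sl2Relations.L_of_K (hR : Sl2Relations q K L E F) {a : ℂ} (ha : a ≠ 0)
    (hK : K v = a • v) : L v = a⁻¹ • v := by
  have e := LinearMap.congr_fun hR.Kinv_K v
  simp only [Module.End.mul_apply, hK, map_smul, Module.End.one_apply] at e
  conv_rhs => rw [← e, smul_smul, inv_mul_cancel₀ ha, one_smul]

theorem Sl2Relations.E_pow_F (hR : Sl2Relations q K L E F) (h : IsGenericParam q s)
    (hc : c ^ 4 = 1) (hK : K v = (c * s ^ (j : ℤ)) • v) (hE : E v = 0) (r : ℕ) :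
    E ((F ^ (r + 1)) v) = (c ^ 2 * (qnum q (r + 1) * qnum q (j - r))) • (F ^ r) v := by
  have hc0 : c ≠ 0 := by rintro rfl; norm_num at hc
  have hs := h.s_ne_zero
  have hcomm : ∀ r : ℕ, E ((F ^ (r + 1)) v) =
      F (E ((F ^ r) v)) + (c ^ 2 * qnum q (j - 2 * r)) • (F ^ r) v := fun r => by
    have e := LinearMap.congr_fun hR.E_F ((F ^ r) v)
    have k1 := hR.K_pow_F h hK r
    have k2 := hR.L_of_K (mul_ne_zero hc0 (zpow_ne_zero _ hs)) k1
    simp only [pow_two, Module.End.mul_apply, LinearMap.smul_apply, LinearMap.sub_apply, k1, k2,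
      map_smul, smul_smul, ← sub_smul] at e
    rw [pow_succ', Module.End.mul_apply, ← sub_eq_iff_eq_add', e]
    congr 1
    have hx : ∀ m : ℤ, q ^ m = (s ^ m) ^ 2 := fun m => by
      rw [← h.sq, ← zpow_natCast, ← zpow_natCast, ← zpow_mul, ← zpow_mul, mul_comm]
    rw [qnum, hx, hx, zpow_neg]
    have hx0 := zpow_ne_zero ((j : ℤ) - 2 * r) hs
    generalize s ^ ((j : ℤ) - 2 * r) = x at *
    have hd := h.sub_inv_ne_zero
    generalize q - q⁻¹ = d at *
    field_simp
    linear_combination hc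
  induction r with
  | zero => 
    rw [hcomm]
    have := h.qnum_mul_succ 0 j
    simp only [qnum_zero, zero_mul, zero_add, mul_zero, sub_zero] at this
    simp [hE, ← this]
  | succ r ih =>
    rw [hcomm, ih, map_smul, ← Module.End.mul_apply, ← pow_succ', ← add_smul]
    congr 1
    have := h.qnum_mul_succ (r + 1) j
    push_cast
    rw [← this, show (j : ℤ) - (r + 1) + 1 = j - r by ring]
    ring

/-- In a finite-dimensional representation a highest weight vector of weight `j` is killed by
`F ^ (j + 1)`: the first `r` with `F ^ (r + 1) v = 0` satisfies `[r + 1] [j - r] = 0`. -/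
theorem Sl2Relations.pow_F_eq_zero [FiniteDimensional ℂ V] (hR : Sl2Relations q K L E F)
    (h : IsGenericParam q s) (hc : c ^ 4 = 1) (hK : K v = (c * s ^ (j : ℤ)) • v) (hE : E v = 0)
    (hv : v ≠ 0) : (F ^ (j + 1)) v = 0 := by
  have hc0 : c ≠ 0 := by rintro rfl; norm_num at hc
  have hs := h.s_ne_zero
  have hex : ∃ r : ℕ, (F ^ r) v = 0 := by
    by_contra! hne
    -- Otherwise the vectors `F ^ r v` would give `K` infinitely many eigenvalues.
    have hinj : Function.Injective fun r : ℕ => c * s ^ ((j : ℤ) - 2 * r) := fun a b hab => by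
      have h1 := mul_left_cancel₀ hc0 hab
      have h2 : q ^ ((b : ℤ) - a) = 1 := by
        rw [← h.sq, ← zpow_natCast, ← zpow_mul,
          show ((2 : ℕ) : ℤ) * ((b : ℤ) - a) = (j - 2 * a) - (j - 2 * b) by push_cast; ring,
          zpow_sub₀ hs, h1, div_self (zpow_ne_zero _ hs)]
      have := h.zpow_eq_one h2
      omega
    refine Set.infinite_range_of_injective hinj (K.finite_hasEigenvalue.subset ?_)
    rintro _ ⟨r, rfl⟩
    exact Module.End.hasEigenvalue_of_hasEigenvector
      (x := (F ^ r) v) ⟨Module.End.mem_eigenspace_iff.2 (hR.K_pow_F h hK r), hne r⟩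
  classical
  have hmin := Nat.find_spec hex
  obtain ⟨r, hr⟩ : ∃ r, Nat.find hex = r + 1 :=
    Nat.exists_eq_succ_of_ne_zero fun h0 => hv (by simpa [h0] using hmin)
  have hne : (F ^ r) v ≠ 0 := Nat.find_min hex (by omega)
  rw [hr] at hmin
  have e := hR.E_pow_F h hc hK hE r
  rw [hmin, map_zero, eq_comm, smul_eq_zero_iff_left hne] at e
  have h1 : qnum q (r + 1) ≠ 0 := h.qnum_ne_zero (by omega)
  have h2 : qnum q (j - r) = 0 := by simpa [hc0, h1] using e
  have h3 : (j : ℤ) - r = 0 := by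
    by_contra h0
    exact h.qnum_ne_zero h0 h2
  rwa [show j = r by omega]

end highestWeight

section operators

variable {q s : ℂ} (h : IsGenericParam q s) {c : ℂ} (hc : c ^ 4 = 1) (n : ℕ)

theorem T_K : T h c hc n (Usl2.gen q .K) = opK s c n := by
  simp [T, Usl2.lift, Usl2.gen]

theorem T_Kinv : T h c hc n (Usl2.gen q .Kinv) = opK s⁻¹ c⁻¹ n := by
  simp [T, Usl2.lift, Usl2.gen]

theorem T_E : T h c hc n (Usl2.gen q .E) = opE q n := by
  simp [T, Usl2.lift, Usl2.gen]

theorem T_F : T h c hc n (Usl2.gen q .F) = c ^ 2 • opF q n := by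
  simp [T, Usl2.lift, Usl2.gen]

end operators

/-- A highest weight vector `v` of weight `c q^{j/2}` in a finite-dimensional representation is the
image of the highest weight vector under an intertwining operator from `T_{j/2}^{(c)}`. -/
theorem exists_intertwiner_of_highestWeight {q s c : ℂ} (h : IsGenericParam q s) (hc : c ^ 4 = 1)
    {V : Type*} [AddCommGroup V] [Module ℂ V] [FiniteDimensional ℂ V] (ρ : Rep (Usl2 q) V) {v : V}
    {j : ℕ} (hK : ρ (Usl2.gen q .K) v = (c * s ^ (j : ℤ)) • v) (hE : ρ (Usl2.gen q .E) v = 0)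
    (hv : v ≠ 0) :
    ∃ φ : Space j →ₗ[ℂ] V, φ (ket j j) = v ∧
      ∀ g x, φ (T h c hc j (Usl2.gen q g) x) = ρ (Usl2.gen q g) (φ x) := by
  have hR := ρ.relations
  have hc0 : c ≠ 0 := by rintro rfl; norm_num at hc
  have hs := h.s_ne_zero
  have hT : ∀ (f g : Space j →ₗ[ℂ] V), (∀ i : ℕ, i ≤ j → f (ket j (j - i)) = g (ket j (j - i))) →
      ∀ x, f x = g x := fun f g hfg x => by
    refine LinearMap.congr_fun ((Pi.basisFun ℂ (Fin (j + 1))).ext fun i => ?_) x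
    rw [← ket_eq]
    have := hfg (j - i) (by omega)
    rwa [Nat.cast_sub (by omega), sub_sub_cancel] at this
  have hFj := hR.pow_F_eq_zero h hc hK hE hv
  -- `F |m⟩ = c^2 [l + m] |m - 1⟩` forces this normalisation of the vectors `F ^ r v`.
  let a : ℕ → ℂ := fun r => ∏ t ∈ Finset.range r, (c ^ 2 * qnum q (j - t))⁻¹
  have ha : ∀ r < j, a (r + 1) * (c ^ 2 * qnum q (j - r)) = a r := fun r hr => by
    have h1 : qnum q ((j : ℤ) - r) ≠ 0 := h.qnum_ne_zero (by omega)
    simp only [a, Finset.prod_range_succ]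
    rw [inv_mul_cancel_right₀ (mul_ne_zero (pow_ne_zero 2 hc0) h1)]
  let φ : Space j →ₗ[ℂ] V := (Pi.basisFun ℂ (Fin (j + 1))).constr ℂ fun i =>
    a (j - i) • (ρ (Usl2.gen q .F) ^ (j - (i : ℕ))) v
  have hφ : ∀ r : ℕ, r ≤ j → φ (ket j (j - r)) = a r • (ρ (Usl2.gen q .F) ^ r) v := fun r hr => by
    have := ket_eq j ⟨j - r, by omega⟩
    dsimp only at this
    rw [← Nat.cast_sub hr, this]
    simp only [φ, Module.Basis.constr_basis, Nat.sub_sub_self hr]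
  refine ⟨φ, by simpa [a] using hφ 0 (Nat.zero_le j), fun g x => ?_⟩
  refine hT (φ ∘ₗ T h c hc j (Usl2.gen q g)) (ρ (Usl2.gen q g) ∘ₗ φ) (fun r hr => ?_) x
  simp only [LinearMap.comp_apply, hφ r hr]
  cases g with
  | K =>
    rw [T_K, opK_ket', map_smul, hφ r hr, map_smul, hR.K_pow_F h hK, smul_comm,
      show 2 * ((j : ℤ) - r) - j = j - 2 * r by ring]
  | Kinv =>
    rw [T_Kinv, opK_ket', map_smul, hφ r hr, map_smul,
      hR.L_of_K (mul_ne_zero hc0 (zpow_ne_zero _ hs)) (hR.K_pow_F h hK r), smul_comm,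
      show 2 * ((j : ℤ) - r) - j = j - 2 * r by ring, mul_inv, inv_zpow]
  | E =>
    rw [T_E, opE_ket q j _ (by omega) (by omega), map_smul, map_smul]
    rcases r with _ | r
    · simp [qnum_zero, hE]
    · rw [show (j : ℤ) - ((r + 1 : ℕ) : ℤ) + 1 = j - r by push_cast; ring, hφ r (by omega),
        hR.E_pow_F h hc hK hE, smul_smul, smul_smul, ← ha r (by omega), sub_sub_cancel]
      congr 1
      push_cast
      ring
  | F =>
    rw [T_F, LinearMap.smul_apply, opF_ket q j _ (by omega) (by omega), map_smul, map_smul,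
      map_smul, ← Module.End.mul_apply, ← pow_succ']
    rcases hr.eq_or_lt with rfl | hr
    · simp [qnum_zero, hFj]
    · rw [show (j : ℤ) - r - 1 = j - (r + 1 : ℕ) by push_cast; ring, hφ (r + 1) hr, smul_smul,
        smul_smul, ← ha r hr]
      congr 1
      ring

/-! ### The operator `E` on the representations `T_l` -/

theorem opE_pow_ket (q : ℂ) (n r : ℕ) (k : ℤ) :
    ∃ a : ℂ, (opE q n ^ r) (ket n k) = a • ket n (k + r) := by
  induction r with
  | zero => exact ⟨1, by simp⟩
  | succ r ih =>
    obtain ⟨a, ha⟩ := ih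
    rw [pow_succ', Module.End.mul_apply, ha, map_smul]
    by_cases hk : k + r < 0 ∨ (n : ℤ) < k + r
    · exact ⟨0, by simp [ket_out n _ hk]⟩
    · exact ⟨a * qnum q (n - (k + r)), by
        rw [opE_ket q n _ (by omega) (by omega), smul_smul, Nat.cast_succ, add_assoc]⟩

theorem opE_pow_eq_zero (q : ℂ) {n r : ℕ} (hr : n < r) : opE q n ^ r = 0 := by
  refine ket_hom_ext fun i => ?_
  obtain ⟨a, ha⟩ := opE_pow_ket q n r i
  rw [ha, ket_out n _ (by omega), smul_zero, LinearMap.zero_apply]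

theorem opE_apply_succ (q : ℂ) (n : ℕ) (x : Space n) (i : Fin n) :
    opE q n x i.succ = qnum q (n - i) * x i.castSucc := by
  rw [opE, Module.Basis.constr_apply_fintype, Finset.sum_apply,
    Finset.sum_eq_single i.castSucc]
  · simp [ket, mul_comm]
  · intro k _ hk
    have : (k : ℕ) ≠ i := fun h0 => hk (Fin.ext h0)
    simp [ket]
    omega
  · simp

/-- The highest weight vectors of `T_l` are the multiples of `|l⟩`. -/
theorem IsGenericParam.eq_smul_of_opE_eq_zero {q s : ℂ} (h : IsGenericParam q s) {n : ℕ}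
    {x : Space n} (hx : opE q n x = 0) : x = x (Fin.last n) • ket n n := by
  ext i
  refine Fin.lastCases ?_ (fun i => ?_) i
  · simp [ket]
  · have e := opE_apply_succ q n x i
    rw [hx, Pi.zero_apply, eq_comm, mul_eq_zero] at e
    have h1 : qnum q (n - i) ≠ 0 := h.qnum_ne_zero (by omega)
    have h2 : (i : ℕ) ≠ n := by omega
    simp [ket, h2, e.resolve_left h1]

/-! ### Tensor products -/

section tensor

variable {q : ℂ} (hq : q ≠ 0) {V W : Type*} [AddCommGroup V] [Module ℂ V] [AddCommGroup W]
  [Module ℂ W] (ρ : Rep (Usl2 q) V) (σ : Rep (Usl2 q) W) (v : V) (w : W)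

theorem Rep.tensor_K : ρ.tensor hq σ (Usl2.gen q .K) (v ⊗ₜ w) =
    ρ (Usl2.gen q .K) v ⊗ₜ σ (Usl2.gen q .K) w := by
  have : Usl2.comul q hq (Usl2.gen q .K) = Usl2.gen q .K ⊗ₜ Usl2.gen q .K := by
    simp [Usl2.comul, Usl2.lift, Usl2.gen]
  simp [Rep.tensor, this]
  rfl

theorem Rep.tensor_Kinv : ρ.tensor hq σ (Usl2.gen q .Kinv) (v ⊗ₜ w) =
    ρ (Usl2.gen q .Kinv) v ⊗ₜ σ (Usl2.gen q .Kinv) w := by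
  have : Usl2.comul q hq (Usl2.gen q .Kinv) = Usl2.gen q .Kinv ⊗ₜ Usl2.gen q .Kinv := by
    simp [Usl2.comul, Usl2.lift, Usl2.gen]
  simp [Rep.tensor, this]
  rfl

theorem Rep.tensor_E : ρ.tensor hq σ (Usl2.gen q .E) (v ⊗ₜ w) =
    ρ (Usl2.gen q .E) v ⊗ₜ σ (Usl2.gen q .K) w +
      ρ (Usl2.gen q .Kinv) v ⊗ₜ σ (Usl2.gen q .E) w := by
  have : Usl2.comul q hq (Usl2.gen q .E) =
      Usl2.gen q .E ⊗ₜ Usl2.gen q .K + Usl2.gen q .Kinv ⊗ₜ Usl2.gen q .E := by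
    simp [Usl2.comul, Usl2.lift, Usl2.gen]
  simp [Rep.tensor, this]
  rfl

end tensor

section clebschGordan

variable {q s : ℂ} (h : IsGenericParam q s) {c c' d : ℂ} (hc : c ^ 4 = 1) (hc' : c' ^ 4 = 1)
  (hd : d ^ 4 = 1)

theorem tensor_K_ket (n n' : ℕ) (a b : ℤ) :
    (T h c hc n).tensor h.ne_zero (T h c' hc' n') (Usl2.gen q .K) (ket n a ⊗ₜ ket n' b) =
      (c * c' * s ^ (2 * a - n + (2 * b - n'))) • (ket n a ⊗ₜ[ℂ] ket n' b) := by
  rw [Rep.tensor_K, T_K, T_K, opK_ket', opK_ket', TensorProduct.smul_tmul_smul,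
    zpow_add₀ h.s_ne_zero, mul_mul_mul_comm]

theorem tensor_Kinv_ket (n n' : ℕ) (a b : ℤ) :
    (T h c hc n).tensor h.ne_zero (T h c' hc' n') (Usl2.gen q .Kinv) (ket n a ⊗ₜ ket n' b) =
      ((c * c')⁻¹ * s⁻¹ ^ (2 * a - n + (2 * b - n'))) • (ket n a ⊗ₜ[ℂ] ket n' b) := by
  rw [Rep.tensor_Kinv, T_Kinv, T_Kinv, opK_ket', opK_ket', TensorProduct.smul_tmul_smul,
    zpow_add₀ (inv_ne_zero h.s_ne_zero), mul_mul_mul_comm, mul_inv]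

/-- For `k ≤ 2 min (l, l')` the space `V_l ⊗ V_{l'}` contains a highest weight vector of weight
`l + l' - k`.  It is a combination of the `|l - p⟩ ⊗ |l' - k + p⟩` whose coefficients are
determined by a two-term recursion. -/
theorem exists_highestWeight_tensor {n n' k : ℕ} (hk : k ≤ n) (hk' : k ≤ n') :
    ∃ v : Space n ⊗[ℂ] Space n', v ≠ 0 ∧
      (T h c hc n).tensor h.ne_zero (T h c' hc' n') (Usl2.gen q .E) v = 0 ∧
      (T h c hc n).tensor h.ne_zero (T h c' hc' n') (Usl2.gen q .K) v =
        (c * c' * s ^ ((n : ℤ) + n' - 2 * k)) • v := by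
  have hs := h.s_ne_zero
  have hc0 : c' ≠ 0 := by rintro rfl; norm_num at hc'
  let A : ℕ → ℂ := fun p => qnum q p * (c' * s ^ (2 * ((n' : ℤ) - k + p) - n'))
  let B : ℕ → ℂ := fun p => c⁻¹ * s⁻¹ ^ (2 * ((n : ℤ) - p) - n) * qnum q (k - p)
  obtain ⟨x, hx0, hx⟩ : ∃ x : ℕ → ℂ, x 0 = 1 ∧ ∀ p, x p * B p = -(x (p + 1) * A (p + 1)) := by
    refine ⟨fun p => Nat.rec 1 (fun p y => -(y * B p) / A (p + 1)) p, rfl, fun p => ?_⟩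
    have : A (p + 1) ≠ 0 :=
      mul_ne_zero (h.qnum_ne_zero (by omega)) (mul_ne_zero hc0 (zpow_ne_zero _ hs))
    dsimp only
    rw [div_mul_cancel₀ _ this, neg_neg]
  refine ⟨∑ p ∈ Finset.range (k + 1), x p • (ket n (n - p) ⊗ₜ ket n' (n' - k + p)), ?_, ?_, ?_⟩
  · intro h0
    -- The coordinate of `|l⟩ ⊗ |l' - k⟩` is `x 0 = 1`.
    have e := congrArg (LinearMap.mul' ℂ ℂ ∘ₗ TensorProduct.map (LinearMap.proj (Fin.last n))
      (LinearMap.proj (R := ℂ) (⟨n' - k, by omega⟩ : Fin (n' + 1)))) h0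
    rw [map_sum, Finset.sum_eq_single 0] at e
    · simp [ket, hx0, Nat.cast_sub hk'] at e
    · intro p _ hp
      have : ¬(n : ℤ) = n - p := by omega
      simp [ket, this]
    · simp
  · -- The recursion makes the sum of the images under `E` telescope.
    let g : ℕ → Space n ⊗[ℂ] Space n' := fun p =>
      (x p * A p) • (ket n (n - p + 1) ⊗ₜ ket n' (n' - k + p))
    have hg : ∀ p ∈ Finset.range (k + 1), (T h c hc n).tensor h.ne_zero (T h c' hc' n')
        (Usl2.gen q .E) (x p • (ket n (n - p) ⊗ₜ ket n' (n' - k + p))) = g p - g (p + 1) := by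
      intro p hp
      rw [Finset.mem_range] at hp
      rw [map_smul, Rep.tensor_E, T_E, T_E, T_K, T_Kinv, opK_ket', opK_ket',
        opE_ket q n _ (by omega) (by omega), opE_ket q n' _ (by omega) (by omega),
        TensorProduct.smul_tmul_smul, TensorProduct.smul_tmul_smul, smul_add, smul_smul, smul_smul]
      refine (congrArg₂ (· + ·) ?_ ?_).trans (sub_eq_add_neg _ _).symm
      · simp [g, A]
      · have e := hx p
        simp only [g]
        rw [show (n : ℤ) - ((p + 1 : ℕ) : ℤ) + 1 = n - p by push_cast; ring,
          show (n' : ℤ) - (n' - k + p) = k - p by ring,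
          show (n' : ℤ) - k + ((p + 1 : ℕ) : ℤ) = n' - k + p + 1 by push_cast; ring]
        refine (congrArg (· • _) e).trans ?_
        module
    have hk0 : x (k + 1) * A (k + 1) = 0 := by
      rw [← neg_eq_zero, ← hx k]
      simp [B, qnum_zero]
    rw [map_sum, Finset.sum_congr rfl hg, Finset.sum_range_sub']
    simp only [g, hk0]
    simp [A, qnum_zero]
  · rw [map_sum, Finset.smul_sum]
    refine Finset.sum_congr rfl fun p _ => ?_
    rw [map_smul, tensor_K_ket, smul_comm,
      show 2 * ((n : ℤ) - p) - n + (2 * (n' - k + p) - n') = n + n' - 2 * k by ring]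

theorem sum_range_dim {n n' : ℕ} {m : ℕ} (hm : m ≤ n) (hm' : m ≤ n') :
    ∑ k ∈ Finset.range (m + 1), (n + n' - 2 * k + 1) = (m + 1) * (n + n' - m + 1) := by
  induction m with
  | zero => simp
  | succ m ih =>
    rw [Finset.sum_range_succ, ih (by omega) (by omega)]
    obtain ⟨a, rfl⟩ := Nat.exists_eq_add_of_le hm
    obtain ⟨b, rfl⟩ := Nat.exists_eq_add_of_le hm'
    rw [show m + 1 + a + (m + 1 + b) - m = m + 2 + a + b by omega,
      show m + 1 + a + (m + 1 + b) - 2 * (m + 1) = a + b by omega,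
      show m + 1 + a + (m + 1 + b) - (m + 1) = m + 1 + a + b by omega]
    ring

/-- `∑_j (2j + 1) = (2l + 1) (2l' + 1)`. -/
theorem sum_cgSpin (n n' : ℕ) :
    ∑ k : Fin (min n n' + 1), (cgSpin n n' k + 1) = (n + 1) * (n' + 1) := by
  simp only [cgSpin]
  rw [Fin.sum_univ_eq_sum_range (fun k => n + n' - 2 * k + 1),
    sum_range_dim (min_le_left _ _) (min_le_right _ _)]
  rcases le_total n n' with hn | hn
  · rw [min_eq_left hn, Nat.add_sub_cancel_left]
  · rw [min_eq_right hn, Nat.add_sub_cancel, mul_comm]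

/-- A linear map that commutes with a nilpotent operator is injective if it is injective on the
kernel of that operator. -/
theorem injective_of_nilpotent {V W : Type*} [AddCommGroup V] [Module ℂ V] [AddCommGroup W]
    [Module ℂ W] {f : V →ₗ[ℂ] W} {N : Module.End ℂ V} {M : Module.End ℂ W}
    (hf : ∀ x, f (N x) = M (f x)) {m : ℕ} (hN : ∀ x, (N ^ m) x = 0)
    (hker : ∀ x, N x = 0 → f x = 0 → x = 0) : Function.Injective f := by
  have key : ∀ r x, (N ^ r) x = 0 → f x = 0 → x = 0 := fun r => by
    induction r with
    | zero => intro x hx _; simpa using hx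
    | succ r ih =>
      intro x hx hfx
      exact hker x (ih (N x) (by rwa [← Module.End.mul_apply, ← pow_succ])
        (by rw [hf, hfx, map_zero])) hfx
  exact (injective_iff_map_eq_zero f).2 fun x => key m x (hN x)

/-- The Clebsch–Gordan decomposition: there are intertwining operators
`T_j^{(c c')} → T_l^{(c)} ⊗ T_{l'}^{(c')}` that together give a bijection from `⨁_j T_j^{(c c')}`. -/
theorem exists_clebschGordan (hcd : c * c' = d) (n n' : ℕ) :
    ∃ φ : ∀ k : Fin (min n n' + 1), Space (cgSpin n n' k) →ₗ[ℂ] Space n ⊗[ℂ] Space n',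
      (∀ k g x, φ k (T h d hd (cgSpin n n' k) (Usl2.gen q g) x) =
        (T h c hc n).tensor h.ne_zero (T h c' hc' n') (Usl2.gen q g) (φ k x)) ∧
      Function.Bijective (DirectSum.toModule ℂ (Fin (min n n' + 1)) _ φ) := by
  subst hcd
  have hs := h.s_ne_zero
  set ρ := (T h c hc n).tensor h.ne_zero (T h c' hc' n')
  have hd0 : c * c' ≠ 0 := by
    intro h0
    norm_num [h0] at hd
  have hex : ∀ k : Fin (min n n' + 1), ∃ v : Space n ⊗[ℂ] Space n', v ≠ 0 ∧
      ρ (Usl2.gen q .E) v = 0 ∧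
      ρ (Usl2.gen q .K) v = (c * c' * s ^ (cgSpin n n' k : ℤ)) • v := fun k => by
    have hk := k.2
    have e : (cgSpin n n' k : ℤ) = (n : ℤ) + n' - 2 * (k : ℕ) := by
      rw [cgSpin]; omega
    rw [e]
    exact exists_highestWeight_tensor h hc hc' (by omega) (by omega)
  choose v hv0 hvE hvK using hex
  choose φ hφv hφ using fun k => exists_intertwiner_of_highestWeight h hd ρ (hvK k) (hvE k) (hv0 k)
  refine ⟨φ, hφ, ?_⟩
  have hli : LinearIndependent ℂ v := by
    refine Module.End.eigenvectors_linearIndependent' (ρ (Usl2.gen q .K)) _ (fun a b hab => ?_) v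
      fun k => ⟨Module.End.mem_eigenspace_iff.2 (hvK k), hv0 k⟩
    have h1 := mul_left_cancel₀ hd0 hab
    have ha := a.2
    have hb := b.2
    have h2 : q ^ ((b : ℤ) - (a : ℤ)) = 1 := by
      rw [← h.sq, ← zpow_natCast, ← zpow_mul, show ((2 : ℕ) : ℤ) * ((b : ℤ) - (a : ℤ)) =
          (cgSpin n n' a : ℤ) - cgSpin n n' b by simp only [cgSpin]; omega,
        zpow_sub₀ hs, h1, div_self (zpow_ne_zero _ hs)]
    have := h.zpow_eq_one h2
    exact Fin.ext (by omega)
  have hinj : Function.Injective (DirectSum.toModule ℂ (Fin (min n n' + 1)) _ φ) := by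
    let N : Module.End ℂ (⨁ k : Fin (min n n' + 1), Space (cgSpin n n' k)) :=
      DirectSum.lmap fun k => opE q (cgSpin n n' k)
    refine injective_of_nilpotent (N := N)
      (M := ρ (Usl2.gen q .E)) (m := n + n' + 1) (fun x => ?_) (fun x => ?_) (fun x hx hfx => ?_)
    · refine LinearMap.congr_fun (f := DirectSum.toModule ℂ _ _ φ ∘ₗ N)
        (g := ρ (Usl2.gen q .E) ∘ₗ DirectSum.toModule ℂ _ _ φ)
        (DirectSum.linearMap_ext ℂ fun k => LinearMap.ext fun y => ?_) x
      have := hφ k .E y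
      rw [T_E] at this
      simp [N, this]
    · have hp : ∀ r, (N ^ r) x =
          DirectSum.lmap (fun k => opE q (cgSpin n n' k) ^ r) x := fun r => by
        induction r with
        | zero => ext; simp
        | succ r ih =>
          rw [pow_succ', Module.End.mul_apply, ih]
          refine DFinsupp.ext fun k => ?_
          simp [N, pow_succ']
      rw [hp]
      refine DFinsupp.ext fun k => ?_
      simp [opE_pow_eq_zero q (show cgSpin n n' k < n + n' + 1 by unfold cgSpin; omega)]
    · have hk : ∀ k, x k = x k (Fin.last _) • ket _ (cgSpin n n' k) := fun k => by
        have : opE q _ (x k) = 0 := DFunLike.congr_fun hx k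
        exact h.eq_smul_of_opE_eq_zero this
      have hsum : ∑ k, x k (Fin.last _) • v k = 0 := by
        rw [← hfx]
        conv_rhs => rw [← DirectSum.sum_univ_of x]
        rw [map_sum]
        refine Finset.sum_congr rfl fun k _ => ?_
        conv_rhs => rw [← DirectSum.lof_eq_of ℂ, DirectSum.toModule_lof, hk k, map_smul, hφv]
      have h0 := Fintype.linearIndependent_iff.1 hli _ hsum
      refine DFinsupp.ext fun k => ?_
      rw [hk k, h0 k, zero_smul]
      rfl
  refine ⟨hinj, (LinearMap.injective_iff_surjective_of_finrank_eq_finrank ?_).1 hinj⟩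
  rw [Module.finrank_directSum, Module.finrank_tensorProduct]
  simpa using sum_cgSpin n n'

theorem tensor_shifted_ket (n n' : ℕ) (a b k : ℤ) :
    ((T h c hc n).tensor h.ne_zero (T h c' hc' n')).shifted k (ket n a ⊗ₜ ket n' b) =
      (q ^ k * (c * c' * s ^ (2 * a - n + (2 * b - n'))) +
        q ^ (-k) * ((c * c')⁻¹ * s⁻¹ ^ (2 * a - n + (2 * b - n')))) •
        (ket n a ⊗ₜ[ℂ] ket n' b) := by
  rw [Rep.shifted, LinearMap.add_apply, LinearMap.smul_apply, LinearMap.smul_apply, tensor_K_ket,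
    tensor_Kinv_ket, smul_smul, smul_smul, ← add_smul]

theorem tensor_extendable (n n' : ℕ)
    (hd' : (c * c') ^ 2 = 1 ∨ ((c * c') ^ 2 = -1 ∧ Odd (n + n'))) :
    ((T h c hc n).tensor h.ne_zero (T h c' hc' n')).Extendable := by
  intro k
  refine isUnit_of_diagonal
    ((Pi.basisFun ℂ (Fin (n + 1))).tensorProduct (Pi.basisFun ℂ (Fin (n' + 1)))) _
    (fun i => q ^ k * (c * c' * s ^ (2 * (i.1 : ℤ) - n + (2 * (i.2 : ℤ) - n'))) +
      q ^ (-k) * ((c * c')⁻¹ * s⁻¹ ^ (2 * (i.1 : ℤ) - n + (2 * (i.2 : ℤ) - n'))))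
    (fun i => ?_) (fun i => ?_)
  · refine h.eigenvalue_ne_zero (hd'.imp_right fun ⟨h1, h2⟩ => ⟨h1, ?_⟩) k
    obtain ⟨r, hr⟩ := h2
    exact ⟨(i.1 : ℤ) + i.2 - r - 1, by omega⟩
  · rw [Module.Basis.tensorProduct_apply, ← ket_eq, ← ket_eq, tensor_shifted_ket]

/-- If `c c' = ±i` and `l + l'` is an integer, then the vector `|-l⟩ ⊗ |-l'⟩` is killed by
one of the operators `q^k q^H + q^{-k} q^{-H}`. -/
theorem not_tensor_extendable {n n' : ℕ} (hd' : (c * c') ^ 2 = -1) (hn : Even (n + n')) :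
    ¬ ((T h c hc n).tensor h.ne_zero (T h c' hc' n')).Extendable := by
  intro hT
  obtain ⟨r, hr⟩ := hn
  have hd0 : c * c' ≠ 0 := by
    intro h0
    norm_num [h0] at hd'
  have hs := h.s_ne_zero
  have e := tensor_shifted_ket h hc hc' n n' 0 0 r
  have hz : q ^ (r : ℤ) * (c * c' * s ^ (2 * 0 - (n : ℤ) + (2 * 0 - n'))) +
      q ^ (-(r : ℤ)) * ((c * c')⁻¹ * s⁻¹ ^ (2 * 0 - (n : ℤ) + (2 * 0 - n'))) = 0 := by
    have e1 : s ^ (2 * 0 - (n : ℤ) + (2 * 0 - n')) = (q ^ (r : ℤ))⁻¹ := by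
      rw [show 2 * 0 - (n : ℤ) + (2 * 0 - n') = ((2 : ℕ) : ℤ) * (-r) by push_cast; omega,
        zpow_mul, zpow_natCast, h.sq, zpow_neg]
    have h1 := zpow_ne_zero (r : ℤ) h.ne_zero
    rw [inv_zpow, e1, inv_inv, zpow_neg]
    generalize c * c' = d at *
    field_simp
    linear_combination hd'
  rw [hz, zero_smul] at e
  have h1 : ket n 0 ⊗ₜ[ℂ] ket n' 0 = 0 :=
    ((Module.End.isUnit_iff _).1 (hT r)).injective (e.trans (map_zero _).symm)
  have h2 := ket_eq n 0
  have h3 := ket_eq n' 0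
  have h4 := ((Pi.basisFun ℂ (Fin (n + 1))).tensorProduct (Pi.basisFun ℂ (Fin (n' + 1)))).ne_zero
    (0, 0)
  rw [Module.Basis.tensorProduct_apply, ← h2, ← h3] at h4
  exact h4 h1

theorem tensorSo3_equivalent (hcd : c * c' = d) (n n' : ℕ)
    (hT : ((T h c hc n).tensor h.ne_zero (T h c' hc' n')).Extendable)
    (hT' : ∀ k : Fin (min n n' + 1), (T h d hd (cgSpin n n' k)).Extendable) :
    (tensorSo3 h (T h c hc n) (T h c' hc' n') hT).Equivalent
      (Rep.directSum fun k : Fin (min n n' + 1) =>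
        (T h d hd (cgSpin n n' k)).compPsi h (hT' k)) := by
  obtain ⟨φ, hφ, hbij⟩ := exists_clebschGordan h hc hc' hd hcd n n'
  exact Rep.equivalent_directSum _ _ φ
    (fun k a x => Rep.compPsi_intertwines h (hT' k) hT (hφ k) a x) hbij

end clebschGordan

/-! ### The sign of `q^H` -/

theorem ringInverse_neg {A : Type*} [Ring A] (a : A) : Ring.inverse (-a) = -Ring.inverse a := by
  by_cases ha : IsUnit a
  · obtain ⟨u, rfl⟩ := ha
    rw [← Units.val_neg, Ring.inverse_unit, Ring.inverse_unit, inv_neg, Units.val_neg]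
  · rw [Ring.inverse_non_unit _ ha, Ring.inverse_non_unit _ (by rwa [IsUnit.neg_iff]), neg_zero]

/-- The reflection `|m⟩ ↦ |-m⟩`. -/
noncomputable def reflection (n : ℕ) : Space n ≃ₗ[ℂ] Space n :=
  LinearEquiv.funCongrLeft ℂ ℂ Fin.revPerm

theorem reflection_ket (n : ℕ) (k : ℤ) : reflection n (ket n k) = ket n (n - k) := by
  ext i
  have := i.2
  simp only [reflection, LinearEquiv.funCongrLeft_apply, LinearMap.funLeft_apply, ket,
    Fin.revPerm_apply, Fin.val_rev]
  congr 1
  rw [eq_iff_iff]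
  omega

section reflection

variable {q s : ℂ} (h : IsGenericParam q s) (n : ℕ) (x : Space n)

theorem reflection_opK (c : ℂ) :
    reflection n (opK s c n x) = opK s⁻¹ c n (reflection n x) := by
  refine LinearMap.congr_fun (f := (reflection n).toLinearMap ∘ₗ opK s c n)
    (g := opK s⁻¹ c n ∘ₗ (reflection n).toLinearMap)
    ((Pi.basisFun ℂ (Fin (n + 1))).ext fun i => ?_) x
  rw [← ket_eq]
  simp only [LinearMap.comp_apply, LinearEquiv.coe_coe, opK_ket', map_smul, reflection_ket]
  rw [inv_zpow', show -(2 * ((n : ℤ) - i) - n) = 2 * i - n by ring]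

theorem reflection_opE (q : ℂ) : reflection n (opE q n x) = opF q n (reflection n x) := by
  refine LinearMap.congr_fun (f := (reflection n).toLinearMap ∘ₗ opE q n)
    (g := opF q n ∘ₗ (reflection n).toLinearMap)
    ((Pi.basisFun ℂ (Fin (n + 1))).ext fun i => ?_) x
  have := i.2
  rw [← ket_eq]
  simp only [LinearMap.comp_apply, LinearEquiv.coe_coe]
  rw [opE_ket q n _ (by omega) (by omega), map_smul, reflection_ket, reflection_ket,
    opF_ket q n _ (by omega) (by omega), sub_sub]

theorem reflection_opF (q : ℂ) : reflection n (opF q n x) = opE q n (reflection n x) := by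
  refine LinearMap.congr_fun (f := (reflection n).toLinearMap ∘ₗ opF q n)
    (g := opE q n ∘ₗ (reflection n).toLinearMap)
    ((Pi.basisFun ℂ (Fin (n + 1))).ext fun i => ?_) x
  have := i.2
  rw [← ket_eq]
  simp only [LinearMap.comp_apply, LinearEquiv.coe_coe]
  rw [opF_ket q n _ (by omega) (by omega), map_smul, reflection_ket, reflection_ket,
    opE_ket q n _ (by omega) (by omega), sub_sub_cancel, sub_sub_eq_add_sub, add_sub_right_comm]

end reflection

theorem opK_neg (s c : ℂ) (n : ℕ) : opK s (-c) n = -opK s c n := by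
  refine ket_hom_ext fun i => ?_
  simp [opK_ket]

/-- Changing the sign of `q^H` changes the signs of `ψ(I_1)` and `ψ(I_2)` and keeps `ψ(I_3)`; the
reflection `|m⟩ ↦ |-m⟩` has the same effect on `R_l^{(1)}`. -/
theorem compPsi_neg_one_equivalent {q s : ℂ} (h : IsGenericParam q s) (n : ℕ)
    (h1 : (-1 : ℂ) ^ 4 = 1) (hT : (T h (-1) h1 n).Extendable) :
    ((T h (-1) h1 n).compPsi h hT).Equivalent (R1 h n) := by
  refine ⟨reflection n, fun a x => ?_⟩
  have hT1 := T1_extendable h n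
  have eK : T h (-1) h1 n (Usl2.gen q .K) = -opK s 1 n := by rw [T_K, opK_neg]
  have eL : T h (-1) h1 n (Usl2.gen q .Kinv) = -opK s⁻¹ 1 n := by
    rw [T_Kinv, inv_neg, inv_one, opK_neg]
  have eF : T h (-1) h1 n (Usl2.gen q .F) = opF q n := by simp [T_F]
  have eK' : T1 h n (Usl2.gen q .K) = opK s 1 n := T_K h _ n
  have eL' : T1 h n (Usl2.gen q .Kinv) = opK s⁻¹ 1 n := by rw [T1, T_Kinv, inv_one]
  have eE' : T1 h n (Usl2.gen q .E) = opE q n := T_E h _ n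
  have eF' : T1 h n (Usl2.gen q .F) = opF q n := by rw [T1, T_F]; simp
  have hJ : ∀ y, reflection n (opK s⁻¹ 1 n y) = opK s 1 n (reflection n y) := fun y => by
    rw [reflection_opK, inv_inv]
  have hD : ∀ y, reflection n (Ring.inverse ((T h (-1) h1 n).shifted 0) y) =
      -Ring.inverse ((T1 h n).shifted 0) (reflection n y) := fun y => by
    have := ringInverse_intertwines (f := (reflection n).toLinearMap) (hT 0) (hT1 0).neg
      (fun z => by
        simp only [Rep.shifted, neg_zero, zpow_zero, one_smul, eK, eL, eK', eL',
          LinearMap.neg_apply, LinearEquiv.coe_coe, LinearMap.add_apply, map_neg, map_add, hJ,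
          reflection_opK]
        abel) y
    rw [ringInverse_neg] at this
    exact this
  refine Rep.intertwines_of_generators (f := (reflection n).toLinearMap) (fun g x => ?_) a x
  have eps : psi h (RingQuot.mkAlgHom ℂ _ (FreeAlgebra.ι ℂ g)) = match g with
      | .I1 => psiI1 q
      | .I2 => psiI2 q
      | .I3 => psiI3 q s := by
    cases g <;> simp [psi]
  simp only [R1, Rep.compPsi, AlgHom.comp_apply, eps, LinearEquiv.coe_coe]
  cases g with
  | I1 =>
    simp only [psiI1, map_smul, map_sub, Rep.extend_K, Rep.extend_Kinv, eK, eL, eK', eL',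
      LinearMap.smul_apply, LinearMap.sub_apply, LinearMap.neg_apply, map_neg, hJ, reflection_opK]
    congr 1
    abel
  | I2 =>
    simp only [psiI2, map_mul, map_sub, Rep.extend_E, Rep.extend_F, Rep.extend_D, T_E, eF, eE', eF',
      Module.End.mul_apply, LinearMap.sub_apply, map_neg, hD, reflection_opE, reflection_opF]
    abel
  | I3 =>
    simp only [psiI3, map_mul, map_add, map_smul, Rep.extend_K, Rep.extend_Kinv, Rep.extend_E,
      Rep.extend_F, Rep.extend_D, T_E, eF, eE', eF', eK, eL, eK', eL', LinearMap.neg_apply,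
      LinearMap.smul_apply, LinearMap.add_apply, Module.End.mul_apply, map_neg, hD, hJ,
      reflection_opK, reflection_opE, reflection_opF, neg_neg]
    abel

theorem units_mul_I_sq (ω : ℤˣ) : (((ω : ℤ) : ℂ) * Complex.I) ^ 2 = -1 := by
  rcases Int.units_eq_one_or ω with rfl | rfl <;> simp

theorem units_mul_I_mul_units_mul_I (ω ω' : ℤˣ) :
    ((ω : ℤ) : ℂ) * Complex.I * (((ω' : ℤ) : ℂ) * Complex.I) = 1 ∨
      ((ω : ℤ) : ℂ) * Complex.I * (((ω' : ℤ) : ℂ) * Complex.I) = -1 := by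
  rcases Int.units_eq_one_or ω with rfl | rfl <;> rcases Int.units_eq_one_or ω' with rfl | rfl <;>
    simp

end QSo3

open QSo3 in
theorem mainTheorem12 (q s : ℂ) (h : IsGenericParam q s) :
    -- `R_l^{(1)} ⊗ R_{l'}^{(1)}` with `l = n/2`, `l' = n'/2`
    (∀ n n' : ℕ,
      ∃ hT : ((T1 h n).tensor h.ne_zero (T1 h n')).Extendable,
        (tensorSo3 h (T1 h n) (T1 h n') hT).Equivalent
          (Rep.directSum fun k : Fin (min n n' + 1) => R1 h (cgSpin n n' k))) ∧
    -- `R_l^{(1)} ⊗ R_{l'}^{(ωi)}`, defined exactly for integral `l`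
    (∀ (ω : ℤˣ) (n n' : ℕ) (hn' : Odd n'),
      (((T1 h n).tensor h.ne_zero (Ti h ω n')).Extendable ↔ Even n) ∧
      ∀ (hn : Even n) (hT : ((T1 h n).tensor h.ne_zero (Ti h ω n')).Extendable),
        (tensorSo3 h (T1 h n) (Ti h ω n') hT).Equivalent
          (Rep.directSum fun k : Fin (min n n' + 1) =>
            Ri h ω (cgSpin n n' k) (cgSpin_odd (hn.add_odd hn') k))) ∧
    -- `R_l^{(ωi)} ⊗ R_{l'}^{(1)}`, defined exactly for integral `l'`
    (∀ (ω : ℤˣ) (n n' : ℕ) (hn : Odd n),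
      (((Ti h ω n).tensor h.ne_zero (T1 h n')).Extendable ↔ Even n') ∧
      ∀ (hn' : Even n') (hT : ((Ti h ω n).tensor h.ne_zero (T1 h n')).Extendable),
        (tensorSo3 h (Ti h ω n) (T1 h n') hT).Equivalent
          (Rep.directSum fun k : Fin (min n n' + 1) =>
            Ri h ω (cgSpin n n' k) (cgSpin_odd (hn.add_even hn') k))) ∧
    -- `R_l^{(ωi)} ⊗ R_{l'}^{(ω'i)}`
    (∀ (ω ω' : ℤˣ) (n n' : ℕ), Odd n → Odd n' →
      ∃ hT : ((Ti h ω n).tensor h.ne_zero (Ti h ω' n')).Extendable,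
        (tensorSo3 h (Ti h ω n) (Ti h ω' n') hT).Equivalent
          (Rep.directSum fun k : Fin (min n n' + 1) => R1 h (cgSpin n n' k))) := by
  have h1 : (1 : ℂ) ^ 4 = 1 := one_pow 4
  refine ⟨fun n n' => ?_, fun ω n n' hn' => ⟨⟨fun hT => ?_, fun hn => ?_⟩, fun hn hT => ?_⟩,
    fun ω n n' hn => ⟨⟨fun hT => ?_, fun hn' => ?_⟩, fun hn' hT => ?_⟩, fun ω ω' n n' hn hn' => ?_⟩
  · exact ⟨tensor_extendable h h1 h1 n n' (Or.inl (by norm_num)),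
      tensorSo3_equivalent h h1 h1 h1 (one_mul 1) n n' _ fun _ => T1_extendable h _⟩
  · by_contra hn
    exact not_tensor_extendable h h1 (unit_I_pow_four ω) (by rw [one_mul, units_mul_I_sq])
      ((Nat.not_even_iff_odd.1 hn).add_odd hn') hT
  · exact tensor_extendable h h1 (unit_I_pow_four ω) n n'
      (Or.inr ⟨by rw [one_mul, units_mul_I_sq], hn.add_odd hn'⟩)
  · exact tensorSo3_equivalent h h1 (unit_I_pow_four ω) (unit_I_pow_four ω) (one_mul _) n n' hT
      fun k => Ti_extendable h ω (cgSpin_odd (hn.add_odd hn') k)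
  · by_contra hn'
    exact not_tensor_extendable h (unit_I_pow_four ω) h1 (by rw [mul_one, units_mul_I_sq])
      (hn.add_odd (Nat.not_even_iff_odd.1 hn')) hT
  · exact tensor_extendable h (unit_I_pow_four ω) h1 n n'
      (Or.inr ⟨by rw [mul_one, units_mul_I_sq], hn.add_even hn'⟩)
  · exact tensorSo3_equivalent h (unit_I_pow_four ω) h1 (unit_I_pow_four ω) (mul_one _) n n' hT
      fun k => Ti_extendable h ω (cgSpin_odd (hn.add_even hn') k)
  · have hω := unit_I_pow_four ω
    have hω' := unit_I_pow_four ω'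
    rcases units_mul_I_mul_units_mul_I ω ω' with hd | hd
    · exact ⟨tensor_extendable h hω hω' n n' (Or.inl (by rw [hd, one_pow])),
        tensorSo3_equivalent h hω hω' h1 hd n n' _ fun _ => T1_extendable h _⟩
    · have h2 : (-1 : ℂ) ^ 4 = 1 := by norm_num
      have hE : ∀ k : Fin (min n n' + 1), (T h (-1) h2 (cgSpin n n' k)).Extendable := fun k =>
        T_extendable h _ h2 _ (Or.inl (by norm_num))
      exact ⟨tensor_extendable h hω hω' n n' (Or.inl (by rw [hd]; norm_num)),
        (tensorSo3_equivalent h hω hω' h2 hd n n' _ hE).trans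
          (Rep.Equivalent.directSum_congr fun k => compPsi_neg_one_equivalent h _ h2 (hE k))⟩
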